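/- Let $R$ be a commutative ring and $\nu\colon \wedge^2R^{5}\to R^{3}$ an $R$-linear map (a net of alternating forms). Let $e_1,\dots,e_5$ and $\alpha,\beta,\gamma$ be the standard bases of $R^5$ and $R^3$, and let $A=(a_{ij})$, $B=(b_{ij})$, $C=(c_{ij})$ be the alternating $5\times5$ matrices with $\nu(e_i\wedge e_j)=a_{ij}\alpha+b_{ij}\beta+c_{ij}\gamma$. For an alternating $5\times 5$ matrix $X$ let $X_j$ be the matrix obtained by deleting the $j$-th row and column, and put $p_j(X)=\operatorname{Pf}(X_j)$ and $p_j(X,Y)=\operatorname{Pf}((X+Y)_j)-\operatorname{Pf}(X_j)-\operatorname{Pf}(Y_j)$. Let $M$ be the $6\times5$ matrix whose $j$-th column is ${}^t\big(p_j(A),\,p_j(B,C),\,p_j(B),\,p_j(C,A),\,p_j(C),\,p_j(A,B)\big)$, let $M_i$ be $M$ with its $i$-th row removed, and set \[ Q_\nu=\begin{pmatrix}\det M_1&-\det M_6&-\det M_4\\-\det M_6&\det M_3&-\det M_2\\-\det M_4&-\det M_2&\det M_5\end{pmatrix}. \] Let $\widetilde\beta(X,X)$ and $\widetilde\beta(X,Y)$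 ($X\ne Y$ among the letters $A,B,C$) be the vectors with components $(-1)^{j-1}p_j(X)$ and $(-1)^{j-1}p_j(X,Y)$, let $\langle\xi|X|\eta\rangle=\sum_{i,j}\xi_ix_{ij}\eta_j$, and let $P'$ be the symmetric $3\times3$ matrix with \[ \begin{aligned} p'_{11}&=\langle\widetilde\beta(A,A)|C|\widetilde\beta(A,B)\rangle,& p'_{12}&=\langle\widetilde\beta(A,A)|C|\widetilde\beta(B,B)\rangle,& p'_{13}&=\langle\widetilde\beta(C,C)|B|\widetilde\beta(A,A)\rangle,\\ p'_{22}&=\langle\widetilde\beta(B,B)|A|\widetilde\beta(B,C)\rangle,& p'_{23}&=\langle\widetilde\beta(B,B)|A|\widetilde\beta(C,C)\rangle,& p'_{33}&=\langle\widetilde\beta(C,C)|B|\widetilde\beta(C,A)\rangle . \end{aligned} \] Let $F\in\mathbb Z[a_{ij},b_{ij},c_{ij}\mid 1\le i<j\le 5]$ be the determinant of $P'$ for the generic alternating matrices $A,B,C$, and write $F(\nu)$ for its value at $\nu$. Then: 1. $\operatorname{adj}(P')=Q_\nu$, $\;P'Q_\nu=Q_\nu P'=F(\nu)E$ with $E$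 the identity matrix, $\;\det P'=F(\nu)$, and $\det Q_\nu=F(\nu)^2$; in particular $\det Q_\nu$ is a perfect square. 2. $F$ is a nonzero polynomial, homogeneous of degree $5$ in each of the three sets of variables $(a_{ij})$, $(b_{ij})$, $(c_{ij})$, and it is a relative invariant: $F(h\circ\nu\circ\wedge^2g)=\det(g)^6\det(h)^5F(\nu)$ for all $R$-linear $g\colon R^5\to R^5$ and $h\colon R^3\to R^3$. 3. Suppose that $\nu$ is of rank $4$, i.e. $\nu$ is surjective and, for every field $K$ that is an $R$-algebra and every nonzero $(x,y,z)\in K^3$, the alternating matrix $xA+yB+zC$ over $K$ has rank $4$. Then $Q_\nu$ is the matrix of the symmetric bilinear form associated with $\nu$: the linear map $S^2(R^3)\to R$ with Gram matrix $Q_\nu$ (sending the product of the $i$-th and $j$-th basis vectors to the $(i,j)$ entry) is surjective, and its kernel is the image of \[G_\nu\colon\wedge^4R^5\to S^2(R^3),\quad a\wedge b\wedge c\wedge d\mapsto\nu(a\wedge b)\nu(c\wedge d)-\nu(a\wedge c)\nu(b\wedge d)+\nu(a\wedge d)\nu(b\wedge c).\] Moreover $F(\nu)$ is a unit of $R$,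 so this form is non-degenerate. -/

import Mathlib

open Matrix MvPolynomial

universe u

noncomputable section

namespace QuinaryNet

/-- The Pfaffian of a `4 × 4` alternating matrix. -/
def pf4 {R : Type*} [CommRing R] (X : Matrix (Fin 4) (Fin 4) R) : R :=
  X 0 1 * X 2 3 - X 0 2 * X 1 3 + X 0 3 * X 1 2

/-- The Pfaffian of the principal `4 × 4` submatrix `X_j` of a `5 × 5` alternating matrix,
obtained by deleting the `j`-th row and the `j`-th column. -/
def pfMinor {R : Type*} [CommRing R] (X : Matrix (Fin 5) (Fin 5) R) (j : Fin 5) : R :=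
  pf4 (X.submatrix j.succAbove j.succAbove)

/-- `Pf ((X + Y)_j) - Pf (X_j) - Pf (Y_j)`. -/
def pfPolar {R : Type*} [CommRing R] (X Y : Matrix (Fin 5) (Fin 5) R) (j : Fin 5) : R :=
  pfMinor (X + Y) j - pfMinor X j - pfMinor Y j

/-- The `6 × 5` matrix `M` attached to three alternating matrices `A`, `B`, `C`. -/
def pfMatrix {R : Type*} [CommRing R] (A B C : Matrix (Fin 5) (Fin 5) R) :
    Matrix (Fin 6) (Fin 5) R :=
  ![pfMinor A, pfPolar B C, pfMinor B, pfPolar C A, pfMinor C, pfPolar A B]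

/-- The determinant of the `5 × 5` submatrix of `M` obtained by removing the `i`-th row
(rows are numbered from `0` here). -/
def rowMinor {R : Type*} [CommRing R] (A B C : Matrix (Fin 5) (Fin 5) R) (i : Fin 6) : R :=
  ((pfMatrix A B C).submatrix i.succAbove id).det

/-- The symmetric matrix `Q` of signed `5 × 5` minors of `M`. -/
def gramMatrix {R : Type*} [CommRing R] (A B C : Matrix (Fin 5) (Fin 5) R) :
    Matrix (Fin 3) (Fin 3) R :=
  !![rowMinor A B C 0, -rowMinor A B C 5, -rowMinor A B C 3;
    -rowMinor A B C 5, rowMinor A B C 2, -rowMinor A B C 1;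
    -rowMinor A B C 3, -rowMinor A B C 1, rowMinor A B C 4]

/-- Ochiai's vector `β̃ (X, X)`; its components are `± Pf (X_j)` with alternating signs. -/
def betaDiag {R : Type*} [CommRing R] (X : Matrix (Fin 5) (Fin 5) R) : Fin 5 → R :=
  fun j => (-1) ^ (j : ℕ) * pfMinor X j

/-- Ochiai's vector `β̃ (X, Y)` for `X ≠ Y`. -/
def betaPolar {R : Type*} [CommRing R] (X Y : Matrix (Fin 5) (Fin 5) R) : Fin 5 → R :=
  fun j => (-1) ^ (j : ℕ) * pfPolar X Y j

/-- Ochiai's trilinear form `⟨ξ | X | η⟩ = ∑ i, j, ξ_i x_{ij} η_j`. -/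
def bracket {R : Type*} [CommRing R] (ξ : Fin 5 → R) (X : Matrix (Fin 5) (Fin 5) R)
    (η : Fin 5 → R) : R :=
  ∑ i, ∑ j, ξ i * X i j * η j

/-- The symmetric matrix `P'` built from Ochiai's invariants. -/
def ochiaiMatrix {R : Type*} [CommRing R] (A B C : Matrix (Fin 5) (Fin 5) R) :
    Matrix (Fin 3) (Fin 3) R :=
  !![bracket (betaDiag A) C (betaPolar A B), bracket (betaDiag A) C (betaDiag B),
      bracket (betaDiag C) B (betaDiag A);
    bracket (betaDiag A) C (betaDiag B), bracket (betaDiag B) A (betaPolar B C),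
      bracket (betaDiag B) A (betaDiag C);
    bracket (betaDiag C) B (betaDiag A), bracket (betaDiag B) A (betaDiag C),
      bracket (betaDiag C) B (betaPolar C A)]

/-- The indeterminates `a_{ij}`, `b_{ij}`, `c_{ij}` with `i < j`. -/
abbrev Var : Type := Fin 3 × {p : Fin 5 × Fin 5 // p.1 < p.2}

/-- The `k`-th generic alternating `5 × 5` matrix. -/
def genericAlt (k : Fin 3) : Matrix (Fin 5) (Fin 5) (MvPolynomial Var ℤ) :=
  fun i j =>
    if h : i < j then X (k, ⟨(i, j), h⟩) else if h : j < i then -X (k, ⟨(j, i), h⟩) else 0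

/-- The polynomial `F = det P'` in the indeterminates `a_{ij}`, `b_{ij}`, `c_{ij}`. -/
def netInvariant : MvPolynomial Var ℤ :=
  (ochiaiMatrix (genericAlt 0) (genericAlt 1) (genericAlt 2)).det

section Net

variable {R : Type u} [CommRing R]

/-- The three alternating matrices of `ν : ⋀² R⁵ → R³`: the `(i, j)` entry of the `k`-th one is
the `k`-th coordinate of `ν (e_i ∧ e_j)`. -/
def netMatrix (ν : ⋀[R]^2 (Fin 5 → R) →ₗ[R] (Fin 3 → R)) (k : Fin 3) :
    Matrix (Fin 5) (Fin 5) R :=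
  fun i j => ν (exteriorPower.ιMulti R 2 ![Pi.single i 1, Pi.single j 1]) k

/-- `Q_ν`. -/
def netGram (ν : ⋀[R]^2 (Fin 5 → R) →ₗ[R] (Fin 3 → R)) : Matrix (Fin 3) (Fin 3) R :=
  gramMatrix (netMatrix ν 0) (netMatrix ν 1) (netMatrix ν 2)

/-- `P'` for `ν`. -/
def netOchiai (ν : ⋀[R]^2 (Fin 5 → R) →ₗ[R] (Fin 3 → R)) : Matrix (Fin 3) (Fin 3) R :=
  ochiaiMatrix (netMatrix ν 0) (netMatrix ν 1) (netMatrix ν 2)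

/-- The value of a polynomial in `a_{ij}`, `b_{ij}`, `c_{ij}` at `ν`. -/
def evalNet (ν : ⋀[R]^2 (Fin 5 → R) →ₗ[R] (Fin 3 → R)) (F : MvPolynomial Var ℤ) : R :=
  aeval (fun v : Var => netMatrix ν v.1 v.2.1.1 v.2.1.2) F

/-- `ν` is a net of alternating forms of rank `4`: it is surjective, and at every field-valued
point of `Spec R` (so in particular at every geometric point), every nonzero member of the net is an alternating form of rank `4`. -/
def IsRankFour (ν : ⋀[R]^2 (Fin 5 → R) →ₗ[R] (Fin 3 → R)) : Prop :=
  Function.Surjective ν ∧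
    ∀ (K : Type u) [Field K] [Algebra R K] (t : Fin 3 → K), t ≠ 0 →
      (∑ k, t k • (netMatrix ν k).map (algebraMap R K)).rank = 4

/-- `S²(R³)`, as the module of homogeneous quadratic polynomials in the basis of `R³`. -/
abbrev SymSq (R : Type u) [CommRing R] : Submodule R (MvPolynomial (Fin 3) R) :=
  homogeneousSubmodule (Fin 3) R 2

/-- The element of `R³` as a linear form in the basis of `R³`. -/
def toLinForm (R : Type u) [CommRing R] : (Fin 3 → R) →ₗ[R] MvPolynomial (Fin 3) R :=
  Fintype.linearCombination R X

/-- `ν (x ∧ y)` as an element of the symmetric algebra of `R³`. -/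
def wedgeForm (ν : ⋀[R]^2 (Fin 5 → R) →ₗ[R] (Fin 3 → R)) (x y : Fin 5 → R) :
    MvPolynomial (Fin 3) R :=
  toLinForm R (ν (exteriorPower.ιMulti R 2 ![x, y]))

section Helpers

variable (ν : ⋀[R]^2 (Fin 5 → R) →ₗ[R] (Fin 3 → R))

theorem wedgeForm_add_left (x x' y : Fin 5 → R) :
    wedgeForm ν (x + x') y = wedgeForm ν x y + wedgeForm ν x' y := by
  have h := (exteriorPower.ιMulti R 2 (M := Fin 5 → R)).map_vecCons_add ![y] x x'
  rw [wedgeForm, h, map_add, map_add, wedgeForm, wedgeForm]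

theorem wedgeForm_smul_left (c : R) (x y : Fin 5 → R) :
    wedgeForm ν (c • x) y = c • wedgeForm ν x y := by
  have h := (exteriorPower.ιMulti R 2 (M := Fin 5 → R)).map_vecCons_smul ![y] c x
  rw [wedgeForm, h, map_smul, map_smul, wedgeForm]

theorem wedgeForm_self (x : Fin 5 → R) : wedgeForm ν x x = 0 := by
  have h := (exteriorPower.ιMulti R 2 (M := Fin 5 → R)).map_eq_zero_of_eq ![x, x]
    (i := 0) (j := 1) rfl (by decide)
  rw [wedgeForm, h, map_zero, map_zero]

theorem wedgeForm_swap (x y : Fin 5 → R) : wedgeForm ν y x = -wedgeForm ν x y := by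
  have h := (exteriorPower.ιMulti R 2 (M := Fin 5 → R)).map_swap ![x, y]
    (i := 0) (j := 1) (by decide)
  have e : ![x, y] ∘ Equiv.swap (0 : Fin 2) 1 = ![y, x] := by
    ext i
    fin_cases i <;> simp
  rw [e] at h
  rw [wedgeForm, h, map_neg, map_neg, wedgeForm]

theorem wedgeForm_add_right (x y y' : Fin 5 → R) :
    wedgeForm ν x (y + y') = wedgeForm ν x y + wedgeForm ν x y' := by
  rw [wedgeForm_swap, wedgeForm_add_left, wedgeForm_swap ν x y, wedgeForm_swap ν x y']
  ring

theorem wedgeForm_smul_right (c : R) (x y : Fin 5 → R) :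
    wedgeForm ν x (c • y) = c • wedgeForm ν x y := by
  rw [wedgeForm_swap, wedgeForm_smul_left, wedgeForm_swap ν x y, smul_neg, neg_neg]

theorem wedgeForm_isHomogeneous (x y : Fin 5 → R) : (wedgeForm ν x y).IsHomogeneous 1 := by
  rw [wedgeForm, toLinForm, Fintype.linearCombination_apply]
  refine IsHomogeneous.sum _ _ _ fun i _ => ?_
  exact (homogeneousSubmodule (Fin 3) R 1).smul_mem _ (isHomogeneous_X R i)

end Helpers

/-- `(a, b, c, d) ↦ ν(a ∧ b) ν(c ∧ d) - ν(a ∧ c) ν(b ∧ d) + ν(a ∧ d) ν(b ∧ c)`. -/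
def squareAlt (ν : ⋀[R]^2 (Fin 5 → R) →ₗ[R] (Fin 3 → R)) :
    (Fin 5 → R) [⋀^Fin 4]→ₗ[R] MvPolynomial (Fin 3) R where
  toFun v := wedgeForm ν (v 0) (v 1) * wedgeForm ν (v 2) (v 3)
    - wedgeForm ν (v 0) (v 2) * wedgeForm ν (v 1) (v 3)
    + wedgeForm ν (v 0) (v 3) * wedgeForm ν (v 1) (v 2)
  map_update_add' := by
    intro hd v i x y
    obtain rfl : hd = instDecidableEqFin 4 := Subsingleton.elim _ _
    have e : ∀ z, (∀ j, j ≠ i → Function.update v i z j = v j) ∧ Function.update v i z i = z :=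
      fun z => ⟨fun j hj => Function.update_of_ne hj z v, Function.update_self i z v⟩
    generalize Function.update v i = w at e ⊢
    match i with
    | 0 =>
      have e1 z := (e z).1 1 (by decide)
      have e2 z := (e z).1 2 (by decide)
      have e3 z := (e z).1 3 (by decide)
      simp only [(e _).2, e1, e2, e3, wedgeForm_add_left]
      ring
    | 1 =>
      have e0 z := (e z).1 0 (by decide)
      have e2 z := (e z).1 2 (by decide)
      have e3 z := (e z).1 3 (by decide)
      simp only [(e _).2, e0, e2, e3, wedgeForm_add_left, wedgeForm_add_right]
      ring
    | 2 =>
      have e0 z := (e z).1 0 (by decide)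
      have e1 z := (e z).1 1 (by decide)
      have e3 z := (e z).1 3 (by decide)
      simp only [(e _).2, e0, e1, e3, wedgeForm_add_left, wedgeForm_add_right]
      ring
    | 3 =>
      have e0 z := (e z).1 0 (by decide)
      have e1 z := (e z).1 1 (by decide)
      have e2 z := (e z).1 2 (by decide)
      simp only [(e _).2, e0, e1, e2, wedgeForm_add_right]
      ring
  map_update_smul' := by
    intro hd v i c x
    obtain rfl : hd = instDecidableEqFin 4 := Subsingleton.elim _ _
    have e : ∀ z, (∀ j, j ≠ i → Function.update v i z j = v j) ∧ Function.update v i z i = z :=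
      fun z => ⟨fun j hj => Function.update_of_ne hj z v, Function.update_self i z v⟩
    generalize Function.update v i = w at e ⊢
    match i with
    | 0 =>
      have e1 z := (e z).1 1 (by decide)
      have e2 z := (e z).1 2 (by decide)
      have e3 z := (e z).1 3 (by decide)
      simp only [(e _).2, e1, e2, e3, wedgeForm_smul_left,
        smul_eq_C_mul]
      ring
    | 1 =>
      have e0 z := (e z).1 0 (by decide)
      have e2 z := (e z).1 2 (by decide)
      have e3 z := (e z).1 3 (by decide)
      simp only [(e _).2, e0, e2, e3, wedgeForm_smul_left, wedgeForm_smul_right,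
        smul_eq_C_mul]
      ring
    | 2 =>
      have e0 z := (e z).1 0 (by decide)
      have e1 z := (e z).1 1 (by decide)
      have e3 z := (e z).1 3 (by decide)
      simp only [(e _).2, e0, e1, e3, wedgeForm_smul_left, wedgeForm_smul_right,
        smul_eq_C_mul]
      ring
    | 3 =>
      have e0 z := (e z).1 0 (by decide)
      have e1 z := (e z).1 1 (by decide)
      have e2 z := (e z).1 2 (by decide)
      simp only [(e _).2, e0, e1, e2, wedgeForm_smul_right,
        smul_eq_C_mul]
      ring
  map_eq_zero_of_eq' := by
    intro v i j h hij
    fin_cases i <;> fin_cases j <;> simp at hij h ⊢ <;>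
      simp only [h, wedgeForm_self, wedgeForm_swap ν (v 0) (v 1), wedgeForm_swap ν (v 0) (v 2),
        wedgeForm_swap ν (v 1) (v 2), wedgeForm_swap ν (v 1) (v 3),
        wedgeForm_swap ν (v 2) (v 3)] <;> ring

/-- `G_ν : ⋀⁴ R⁵ → S²(R³)`. -/
def netSquare (ν : ⋀[R]^2 (Fin 5 → R) →ₗ[R] (Fin 3 → R)) :
    ⋀[R]^4 (Fin 5 → R) →ₗ[R] SymSq R :=
  exteriorPower.alternatingMapLinearEquiv ((squareAlt ν).codRestrict (SymSq R) fun v => by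
    have h := wedgeForm_isHomogeneous ν
    exact (((h (v 0) (v 1)).mul (h (v 2) (v 3))).sub ((h (v 0) (v 2)).mul (h (v 1) (v 3)))).add
      ((h (v 0) (v 3)).mul (h (v 1) (v 2))))

/-- The linear map `S²(R³) → R` sending the product of the `i`-th and the `j`-th basis vectors to
`Q i j` (`i ≤ j`): the symmetric bilinear form with the symmetric Gram matrix `Q`. -/
def symForm (Q : Matrix (Fin 3) (Fin 3) R) : SymSq R →ₗ[R] R :=
  (∑ i, ∑ j ∈ Finset.Ici i,
    Q i j • lcoeff R (Finsupp.single i 1 + Finsupp.single j 1)).comp (SymSq R).subtype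

end Net

end QuinaryNet

end

/-! Write β(X) for `betaDiag X`, β(X,Y) for its polarization `betaPolar X Y`. Everything rests on
the cubic identity X β(X) = 0 and its polarizations X β(X,Y) + Y β(X) = 0 and A β(B,C) + B β(C,A) +
C β(A,B) = 0. Together with skew-symmetry they force every pairing of two of the six β-vectors under
A, B or C to be zero or ± an entry of P' (`pairing_table`).

Adjugate. Pfaffian Cauchy–Binet gives β(U X Uᵀ) = adj(U)ᵀ β(X). If row r of U is β(X) itself, the
r-th component is det U. Taking for U five of the six β-vectors, a maximal minor of M becomes a 4 ×
4 Pfaffian of the table, that is, up to sign a 2 × 2 minor of P'. Hence adj P' = Q without expanding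
any 5 × 5 determinant, and the identities of determinants follow.

Invariance. A change U of R⁵ multiplies P' by det(U)². A change h of R³ turns it into det(h) · h P'
hᵀ, by trilinearity and the table. Taking determinants gives the exponents 6 and 5.

Cokernel. Evaluating the form on s is the Laplace expansion of det [s | M], while G_ν is M in
coordinates. So the form kills the image of G_ν. Conversely, Cramer's rule puts each maximal minor
times s in that image whenever the form kills s. Once det Q is a unit the minors generate R, giving
both exactness and surjectivity.

Unit. It is enough that det P' ≠ 0 over an algebraically closed field
(`IsRegularNet.det_ochiaiMatrix_ne_zero`). A null vector of P', moved to the third basis vector,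
puts all six β-vectors in one hyperplane, so adj P' = Q = 0 and P' has corank at least 2. Then β(B),
β(C), β(B,C) span a 3-space isotropic for the whole net in a suitable basis, and some member of the
net has rank at most 1 on it, hence a kernel of dimension at least 2, contrary to rank 4. -/

noncomputable section

namespace QuinaryNet

/-! ### Pfaffian vectors of alternating 5 × 5 matrices and their syzygies -/

section Alternating

variable {R : Type*} [CommRing R]

/-- A square matrix is alternating if it is skew-symmetric with zero diagonal. -/
def IsAlternating {ι : Type*} (X : Matrix ι ι R) : Prop :=
  (∀ i, X i i = 0) ∧ ∀ i j, X j i = -X i j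

theorem IsAlternating.add {ι : Type*} {X Y : Matrix ι ι R} (hX : IsAlternating X)
    (hY : IsAlternating Y) : IsAlternating (X + Y) :=
  ⟨fun i => by simp [hX.1, hY.1], fun i j => by simp [hX.2 i j, hY.2 i j]; ring⟩

theorem IsAlternating.map {S ι : Type*} [CommRing S] {X : Matrix ι ι R} (f : R →+* S)
    (hX : IsAlternating X) : IsAlternating (X.map f) :=
  ⟨fun i => by simp [hX.1], fun i j => by simp [hX.2 i j]⟩

/-- The alternating `5 × 5` matrix with given entries above the diagonal. -/
def altOf (x : Matrix (Fin 5) (Fin 5) R) : Matrix (Fin 5) (Fin 5) R :=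
  !![0, x 0 1, x 0 2, x 0 3, x 0 4;
    -x 0 1, 0, x 1 2, x 1 3, x 1 4;
    -x 0 2, -x 1 2, 0, x 2 3, x 2 4;
    -x 0 3, -x 1 3, -x 2 3, 0, x 3 4;
    -x 0 4, -x 1 4, -x 2 4, -x 3 4, 0]

theorem isAlternating_altOf (x : Matrix (Fin 5) (Fin 5) R) : IsAlternating (altOf x) :=
  ⟨fun i => by fin_cases i <;> rfl, fun i j => by fin_cases i <;> fin_cases j <;> simp [altOf]⟩

theorem IsAlternating.eq_altOf {X : Matrix (Fin 5) (Fin 5) R} (hX : IsAlternating X) :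
    X = altOf X := by
  ext i j
  fin_cases i <;> fin_cases j <;> simp [altOf, hX.1] <;> exact hX.2 _ _

theorem betaDiag_explicit (X : Matrix (Fin 5) (Fin 5) R) : betaDiag X =
    ![X 1 2 * X 3 4 - X 1 3 * X 2 4 + X 1 4 * X 2 3,
      -(X 0 2 * X 3 4 - X 0 3 * X 2 4 + X 0 4 * X 2 3),
      X 0 1 * X 3 4 - X 0 3 * X 1 4 + X 0 4 * X 1 3,
      -(X 0 1 * X 2 4 - X 0 2 * X 1 4 + X 0 4 * X 1 2),
      X 0 1 * X 2 3 - X 0 2 * X 1 3 + X 0 3 * X 1 2] := by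
  ext j
  fin_cases j <;> simp [betaDiag, pfMinor, pf4, Fin.succAbove, Fin.lt_def] <;> ring

theorem betaPolar_eq (X Y : Matrix (Fin 5) (Fin 5) R) :
    betaPolar X Y = betaDiag (X + Y) - betaDiag X - betaDiag Y := by
  ext j
  simp only [betaPolar, pfPolar, betaDiag, Pi.sub_apply]
  ring

theorem betaPolar_comm (X Y : Matrix (Fin 5) (Fin 5) R) : betaPolar X Y = betaPolar Y X := by
  rw [betaPolar_eq, betaPolar_eq, add_comm Y X]
  abel

theorem betaDiag_add (X Y : Matrix (Fin 5) (Fin 5) R) :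
    betaDiag (X + Y) = betaDiag X + betaPolar X Y + betaDiag Y := by
  rw [betaPolar_eq]
  abel

theorem betaDiag_smul (c : R) (X : Matrix (Fin 5) (Fin 5) R) :
    betaDiag (c • X) = c ^ 2 • betaDiag X := by
  ext j
  fin_cases j <;> simp [betaDiag_explicit] <;> ring

theorem betaPolar_apply (X Y : Matrix (Fin 5) (Fin 5) R) (j : Fin 5) :
    betaPolar X Y j = betaDiag (X + Y) j - betaDiag X j - betaDiag Y j := by
  rw [betaPolar_eq]
  rfl

theorem betaPolar_add_left (X Y Z : Matrix (Fin 5) (Fin 5) R) :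
    betaPolar (X + Y) Z = betaPolar X Z + betaPolar Y Z := by
  ext j
  fin_cases j <;> simp [betaPolar_apply, betaDiag_explicit] <;> ring

theorem betaPolar_smul_left (c : R) (X Z : Matrix (Fin 5) (Fin 5) R) :
    betaPolar (c • X) Z = c • betaPolar X Z := by
  ext j
  fin_cases j <;> simp [betaPolar_apply, betaDiag_explicit] <;> ring

theorem betaPolar_add_right (X Y Z : Matrix (Fin 5) (Fin 5) R) :
    betaPolar Z (X + Y) = betaPolar Z X + betaPolar Z Y := by
  rw [betaPolar_comm, betaPolar_add_left, betaPolar_comm X, betaPolar_comm Y]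

theorem betaPolar_smul_right (c : R) (X Z : Matrix (Fin 5) (Fin 5) R) :
    betaPolar Z (c • X) = c • betaPolar Z X := by
  rw [betaPolar_comm, betaPolar_smul_left, betaPolar_comm X]

theorem betaPolar_self (X : Matrix (Fin 5) (Fin 5) R) : betaPolar X X = 2 • betaDiag X := by
  ext j
  fin_cases j <;> simp [betaPolar_apply, betaDiag_explicit] <;> ring

/-- Pfaffian analogue of expanding a determinant along a repeated row. The next two lemmas are its
polarizations: the part linear in `Y` after replacing `X` by `X + Y`, and the trilinear part. -/
theorem IsAlternating.mulVec_betaDiag {X : Matrix (Fin 5) (Fin 5) R} (hX : IsAlternating X) :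
    X *ᵥ betaDiag X = 0 := by
  rw [hX.eq_altOf]
  ext j
  fin_cases j <;> simp [betaDiag_explicit, altOf, Matrix.mulVec, dotProduct, Fin.sum_univ_five] <;>
    ring

theorem mulVec_betaPolar_add_mulVec_betaDiag {X Y : Matrix (Fin 5) (Fin 5) R}
    (hX : IsAlternating X) (hY : IsAlternating Y) :
    X *ᵥ betaPolar X Y + Y *ᵥ betaDiag X = 0 := by
  rw [hX.eq_altOf, hY.eq_altOf]
  ext j
  fin_cases j <;> simp [betaPolar_apply, betaDiag_explicit, altOf, dotProduct,
    Fin.sum_univ_five] <;> ring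

theorem mulVec_betaPolar_cyclic {X Y Z : Matrix (Fin 5) (Fin 5) R}
    (hX : IsAlternating X) (hY : IsAlternating Y) (hZ : IsAlternating Z) :
    X *ᵥ betaPolar Y Z + Y *ᵥ betaPolar Z X + Z *ᵥ betaPolar X Y = 0 := by
  rw [hX.eq_altOf, hY.eq_altOf, hZ.eq_altOf]
  ext j
  fin_cases j <;> simp [betaPolar_apply, betaDiag_explicit, altOf, dotProduct,
    Fin.sum_univ_five] <;> ring

theorem bracket_eq_dotProduct (ξ : Fin 5 → R) (X : Matrix (Fin 5) (Fin 5) R) (η : Fin 5 → R) :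
    bracket ξ X η = ξ ⬝ᵥ X *ᵥ η := by
  simp only [bracket, dotProduct, Matrix.mulVec, Finset.mul_sum, mul_assoc]

theorem IsAlternating.bracket_self {X : Matrix (Fin 5) (Fin 5) R} (hX : IsAlternating X)
    (ξ : Fin 5 → R) : bracket ξ X ξ = 0 := by
  rw [hX.eq_altOf]
  simp [bracket, altOf, Fin.sum_univ_five]
  ring

theorem IsAlternating.bracket_swap {X : Matrix (Fin 5) (Fin 5) R} (hX : IsAlternating X)
    (ξ η : Fin 5 → R) : bracket η X ξ = -bracket ξ X η := by
  simp only [bracket]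
  rw [Finset.sum_comm, ← Finset.sum_neg_distrib]
  refine Finset.sum_congr rfl fun i _ => ?_
  rw [← Finset.sum_neg_distrib]
  refine Finset.sum_congr rfl fun j _ => ?_
  rw [hX.2 i j]
  ring

/-- The six vectors `β̃`, in the order of the rows of `pfMatrix`. -/
def betaMatrix (A B C : Matrix (Fin 5) (Fin 5) R) : Matrix (Fin 6) (Fin 5) R :=
  ![betaDiag A, betaPolar B C, betaDiag B, betaPolar C A, betaDiag C, betaPolar A B]

theorem betaMatrix_apply (A B C : Matrix (Fin 5) (Fin 5) R) (i : Fin 6) (j : Fin 5) :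
    betaMatrix A B C i j = (-1) ^ (j : ℕ) * pfMatrix A B C i j := by
  fin_cases i <;> rfl

set_option maxHeartbeats 2000000 in
/-- Pairings of the six vectors `β̃` satisfying the syzygies of the Pfaffian vectors are
determined by the six entries of `P'`. -/
theorem pairing_table (a b c : Fin 6 → Fin 6 → R)
    (a0 : ∀ i, a i i = 0) (b0 : ∀ i, b i i = 0) (c0 : ∀ i, c i i = 0)
    (as : ∀ i j, a j i = -a i j) (bs : ∀ i j, b j i = -b i j) (cs : ∀ i j, c j i = -c i j)
    (h1 : ∀ i, a i 0 = 0) (h2 : ∀ i, b i 2 = 0) (h3 : ∀ i, c i 4 = 0)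
    (h4 : ∀ i, a i 5 + b i 0 = 0) (h5 : ∀ i, b i 5 + a i 2 = 0)
    (h6 : ∀ i, b i 1 + c i 2 = 0) (h7 : ∀ i, c i 1 + b i 4 = 0)
    (h8 : ∀ i, c i 3 + a i 4 = 0) (h9 : ∀ i, a i 3 + c i 0 = 0)
    (h10 : ∀ i, a i 1 + b i 3 + c i 5 = 0) :
    (a = !![0, 0, 0, 0, 0, 0;
        0, 0, -a 2 1, b 4 0, b 4 3, -c 0 2;
        0, a 2 1, 0, c 0 2, a 2 4, 0;
        0, -b 4 0, -c 0 2, 0, 0, -c 0 5;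
        0, -b 4 3, -a 2 4, 0, 0, -b 4 0;
        0, c 0 2, 0, c 0 5, b 4 0, 0]) ∧
    (b = !![0, -c 0 2, 0, -c 0 5, -b 4 0, 0;
        c 0 2, 0, 0, a 2 4, 0, a 2 1;
        0, 0, 0, 0, 0, 0;
        c 0 5, -a 2 4, 0, 0, -b 4 3, c 0 2;
        b 4 0, 0, 0, b 4 3, 0, a 2 4;
        0, -a 2 1, 0, -c 0 2, -a 2 4, 0]) ∧
    (c = !![0, b 4 0, c 0 2, 0, 0, c 0 5;
        -b 4 0, 0, 0, -b 4 3, 0, -a 2 4;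
        -c 0 2, 0, 0, -a 2 4, 0, -a 2 1;
        0, b 4 3, a 2 4, 0, 0, b 4 0;
        0, 0, 0, 0, 0, 0;
        -c 0 5, a 2 4, a 2 1, -b 4 0, 0, 0]) := by
  -- The syzygies are solved for columns 0, 3, 5 of `c` and 0, 1, 4, 5 of `b`; with skew-symmetry a
  -- finite linear system in the individual entries remains.
  have e3 : ∀ i, c i 3 = -a i 4 := fun i => by linear_combination h8 i
  have e0 : ∀ i, c i 0 = -a i 3 := fun i => by linear_combination h9 i
  have e5 : ∀ i, c i 5 = -a i 1 - b i 3 := fun i => by linear_combination h10 i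
  have f1 : ∀ i, b i 1 = -c i 2 := fun i => by linear_combination h6 i
  have f4 : ∀ i, b i 4 = -c i 1 := fun i => by linear_combination h7 i
  have f5 : ∀ i, b i 5 = -a i 2 := fun i => by linear_combination h5 i
  have f0 : ∀ i, b i 0 = -a i 5 := fun i => by linear_combination h4 i
  clear h4 h5 h6 h7 h8 h9 h10
  simp only [Fin.forall_fin_succ] at *
  simp at *
  refine ⟨?_, ?_, ?_⟩ <;> ext i j <;> fin_cases i <;> fin_cases j <;> simp 
  all_goals grind

end Alternating

/-! ### Change of basis in R⁵, and adj P' = Q -/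

section Covariance

variable {R : Type*} [CommRing R]

-- Cauchy–Binet for Pfaffians: the 4-subsets of five indices are the complements of single indices.
set_option maxHeartbeats 4000000 in
theorem pf4_mul_altOf_mul_transpose (V : Matrix (Fin 4) (Fin 5) R) (x : Matrix (Fin 5) (Fin 5) R) :
    pf4 (V * altOf x * Vᵀ) =
      ∑ k, (V.submatrix id k.succAbove).det * pfMinor (altOf x) k := by
  have h : ∀ i j, (V * altOf x * Vᵀ) i j =
      x 0 1 * (V i 0 * V j 1 - V i 1 * V j 0) + x 0 2 * (V i 0 * V j 2 - V i 2 * V j 0)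
      + x 0 3 * (V i 0 * V j 3 - V i 3 * V j 0) + x 0 4 * (V i 0 * V j 4 - V i 4 * V j 0)
      + x 1 2 * (V i 1 * V j 2 - V i 2 * V j 1) + x 1 3 * (V i 1 * V j 3 - V i 3 * V j 1)
      + x 1 4 * (V i 1 * V j 4 - V i 4 * V j 1) + x 2 3 * (V i 2 * V j 3 - V i 3 * V j 2)
      + x 2 4 * (V i 2 * V j 4 - V i 4 * V j 2) + x 3 4 * (V i 3 * V j 4 - V i 4 * V j 3) := by
    intro i j
    simp [altOf, Matrix.mul_apply, Fin.sum_univ_five]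
    ring
  simp only [pf4, h, det_succ_row_zero, Fin.sum_univ_succ]
  simp [Fin.succAbove, Fin.lt_def, pfMinor, pf4, altOf]
  ring

/-- Cauchy–Binet is applied to `U` without row `j`. The 4 × 4 minors that appear are cofactors of
`U`, and the alternating signs in `betaDiag` are exactly the cofactor signs. -/
theorem betaDiag_conj {X : Matrix (Fin 5) (Fin 5) R} (hX : IsAlternating X)
    (U : Matrix (Fin 5) (Fin 5) R) :
    betaDiag (U * X * Uᵀ) = U.adjugateᵀ *ᵥ betaDiag X := by
  ext j
  have h : (U * X * Uᵀ).submatrix j.succAbove j.succAbove =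
      U.submatrix j.succAbove id * altOf X * (U.submatrix j.succAbove id)ᵀ := by
    rw [← hX.eq_altOf]
    rfl
  rw [betaDiag, pfMinor, h, pf4_mul_altOf_mul_transpose, ← hX.eq_altOf, Matrix.mulVec, dotProduct,
    Finset.mul_sum]
  refine Finset.sum_congr rfl fun k _ => ?_
  rw [transpose_apply, adjugate_fin_succ_eq_det_submatrix, betaDiag, submatrix_submatrix]
  have : ((-1 : R) ^ (k : ℕ)) * (-1) ^ (k : ℕ) = 1 := by
    rw [← mul_pow]
    simp
  simp only [Function.comp_id, Function.id_comp]
  rw [pow_add]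
  linear_combination (-(-1) ^ (j : ℕ) * (U.submatrix j.succAbove k.succAbove).det * pfMinor X k) *
    this

theorem conj_apply_eq_bracket {ι : Type*} (U : Matrix ι (Fin 5) R)
    (X : Matrix (Fin 5) (Fin 5) R) (i j : ι) :
    (U * X * Uᵀ) i j = bracket (fun k => U i k) X (fun k => U j k) := by
  simp only [Matrix.mul_apply, bracket, transpose_apply, Finset.sum_mul]
  exact Finset.sum_comm

theorem IsAlternating.conj {ι : Type*} {X : Matrix (Fin 5) (Fin 5) R} (hX : IsAlternating X)
    (U : Matrix ι (Fin 5) R) : IsAlternating (U * X * Uᵀ) :=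
  ⟨fun i => by rw [conj_apply_eq_bracket, hX.bracket_self],
    fun i j => by rw [conj_apply_eq_bracket, conj_apply_eq_bracket, hX.bracket_swap]⟩

theorem betaPolar_conj {X Y : Matrix (Fin 5) (Fin 5) R} (hX : IsAlternating X)
    (hY : IsAlternating Y) (U : Matrix (Fin 5) (Fin 5) R) :
    betaPolar (U * X * Uᵀ) (U * Y * Uᵀ) = U.adjugateᵀ *ᵥ betaPolar X Y := by
  rw [betaPolar_eq, ← Matrix.add_mul, ← Matrix.mul_add, betaDiag_conj (hX.add hY),
    betaDiag_conj hX, betaDiag_conj hY, betaPolar_eq, Matrix.mulVec_sub, Matrix.mulVec_sub]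

theorem bracket_conj (U X : Matrix (Fin 5) (Fin 5) R) (ξ η : Fin 5 → R) :
    bracket (U.adjugateᵀ *ᵥ ξ) (U * X * Uᵀ) (U.adjugateᵀ *ᵥ η) = U.det ^ 2 * bracket ξ X η := by
  rw [bracket_eq_dotProduct, bracket_eq_dotProduct, Matrix.mulVec_mulVec, Matrix.mulVec_transpose,
    ← Matrix.dotProduct_mulVec, Matrix.mulVec_mulVec]
  have h : U.adjugate * (U * X * Uᵀ * U.adjugateᵀ) = U.det ^ 2 • X := by
    rw [Matrix.mul_assoc, ← Matrix.transpose_mul, adjugate_mul, ← Matrix.mul_assoc,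
      ← Matrix.mul_assoc, adjugate_mul]
    simp [smul_smul, pow_two]
  rw [h, Matrix.smul_mulVec, dotProduct_smul, smul_eq_mul]

theorem ochiaiMatrix_conj {A B C : Matrix (Fin 5) (Fin 5) R} (hA : IsAlternating A)
    (hB : IsAlternating B) (hC : IsAlternating C) (U : Matrix (Fin 5) (Fin 5) R) :
    ochiaiMatrix (U * A * Uᵀ) (U * B * Uᵀ) (U * C * Uᵀ) = U.det ^ 2 • ochiaiMatrix A B C := by
  simp only [ochiaiMatrix, betaDiag_conj hA, betaDiag_conj hB, betaDiag_conj hC,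
    betaPolar_conj hA hB, betaPolar_conj hB hC, betaPolar_conj hC hA, bracket_conj]
  ext i j
  fin_cases i <;> fin_cases j <;> rfl

/-- Component `r` of `adj(U)ᵀ β(X)` pairs row `r` of `U` with its own cofactors. This turns a 5 × 5
determinant into a single Pfaffian. -/
theorem betaDiag_conj_apply_of_row_eq {X : Matrix (Fin 5) (Fin 5) R} (hX : IsAlternating X)
    (U : Matrix (Fin 5) (Fin 5) R) (r : Fin 5) (hr : U r = betaDiag X) :
    betaDiag (U * X * Uᵀ) r = U.det := by
  rw [betaDiag_conj hX, ← hr]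
  have := congrFun (congrFun (mul_adjugate U) r) r
  rw [Matrix.smul_apply, one_apply_eq, smul_eq_mul, mul_one, Matrix.mul_apply] at this
  rw [← this]
  simp only [Matrix.mulVec, dotProduct, transpose_apply, mul_comm]

/-- The pairings of the six vectors `β̃` under the three forms of a net, in terms of `P'`. -/
def pairingMatrix (P : Matrix (Fin 3) (Fin 3) R) : Fin 3 → Matrix (Fin 6) (Fin 6) R :=
  ![!![0, 0, 0, 0, 0, 0;
        0, 0, -P 1 1, P 0 2, P 2 2, -P 0 1;
        0, P 1 1, 0, P 0 1, P 1 2, 0;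
        0, -P 0 2, -P 0 1, 0, 0, -P 0 0;
        0, -P 2 2, -P 1 2, 0, 0, -P 0 2;
        0, P 0 1, 0, P 0 0, P 0 2, 0],
    !![0, -P 0 1, 0, -P 0 0, -P 0 2, 0;
        P 0 1, 0, 0, P 1 2, 0, P 1 1;
        0, 0, 0, 0, 0, 0;
        P 0 0, -P 1 2, 0, 0, -P 2 2, P 0 1;
        P 0 2, 0, 0, P 2 2, 0, P 1 2;
        0, -P 1 1, 0, -P 0 1, -P 1 2, 0],
    !![0, P 0 2, P 0 1, 0, 0, P 0 0;
        -P 0 2, 0, 0, -P 2 2, 0, -P 1 2;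
        -P 0 1, 0, 0, -P 1 2, 0, -P 1 1;
        0, P 2 2, P 1 2, 0, 0, P 0 2;
        0, 0, 0, 0, 0, 0;
        -P 0 0, P 1 2, P 1 1, -P 0 2, 0, 0]]

theorem bracket_betaMatrix {A B C : Matrix (Fin 5) (Fin 5) R} (hA : IsAlternating A)
    (hB : IsAlternating B) (hC : IsAlternating C) (k : Fin 3) (i j : Fin 6) :
    bracket (betaMatrix A B C i) ((![A, B, C] : Fin 3 → _) k) (betaMatrix A B C j) =
      pairingMatrix (ochiaiMatrix A B C) k i j := by
  have key := pairing_table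
    (fun i j => bracket (betaMatrix A B C i) A (betaMatrix A B C j))
    (fun i j => bracket (betaMatrix A B C i) B (betaMatrix A B C j))
    (fun i j => bracket (betaMatrix A B C i) C (betaMatrix A B C j))
    (fun i => hA.bracket_self _) (fun i => hB.bracket_self _) (fun i => hC.bracket_self _)
    (fun i j => hA.bracket_swap _ _) (fun i j => hB.bracket_swap _ _)
    (fun i j => hC.bracket_swap _ _)
  simp only [bracket_eq_dotProduct, ← dotProduct_add] at key
  have hz : ∀ {v : Fin 5 → R} (i : Fin 6), v = 0 → betaMatrix A B C i ⬝ᵥ v = 0 := by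
    rintro v i rfl
    exact dotProduct_zero _
  obtain ⟨h1, h2, h3⟩ := key (fun i => hz i hA.mulVec_betaDiag) (fun i => hz i hB.mulVec_betaDiag)
    (fun i => hz i hC.mulVec_betaDiag)
    (fun i => hz i (mulVec_betaPolar_add_mulVec_betaDiag hA hB))
    (fun i => hz i (by
      have := mulVec_betaPolar_add_mulVec_betaDiag hB hA
      rwa [betaPolar_comm] at this))
    (fun i => hz i (mulVec_betaPolar_add_mulVec_betaDiag hB hC))
    (fun i => hz i (by
      have := mulVec_betaPolar_add_mulVec_betaDiag hC hB
      rwa [betaPolar_comm] at this))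
    (fun i => hz i (mulVec_betaPolar_add_mulVec_betaDiag hC hA))
    (fun i => hz i (by
      have := mulVec_betaPolar_add_mulVec_betaDiag hA hC
      rwa [betaPolar_comm] at this))
    (fun i => hz i (mulVec_betaPolar_cyclic hA hB hC))
  simp only [← bracket_eq_dotProduct] at h1 h2 h3
  fin_cases k
  · exact congrFun (congrFun h1 i) j
  · exact congrFun (congrFun h2 i) j
  · exact congrFun (congrFun h3 i) j

theorem rowMinor_eq_det_betaMatrix (A B C : Matrix (Fin 5) (Fin 5) R) (i : Fin 6) :
    rowMinor A B C i = Matrix.det ((betaMatrix A B C).submatrix i.succAbove id) := by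
  have h : (betaMatrix A B C).submatrix i.succAbove id =
      (pfMatrix A B C).submatrix i.succAbove id *
        Matrix.diagonal fun j : Fin 5 => (-1 : R) ^ (j : ℕ) := by
    ext r j
    rw [Matrix.mul_diagonal, submatrix_apply, submatrix_apply, betaMatrix_apply]
    exact mul_comm _ _
  rw [h, det_mul, det_diagonal, rowMinor, Fin.prod_univ_five]
  simp only [Fin.coe_ofNat_eq_mod]
  norm_num

/-- For `U` the five remaining β-vectors, `U * X * Uᵀ` is the matrix of their pairings, known from
the table. The minor is therefore quadratic in the entries of P'. -/
theorem rowMinor_eq_pairing {A B C : Matrix (Fin 5) (Fin 5) R} (hA : IsAlternating A)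
    (hB : IsAlternating B) (hC : IsAlternating C) (i : Fin 6) (k : Fin 3) (r : Fin 5)
    (hr : betaMatrix A B C (i.succAbove r) = betaDiag ((![A, B, C] : Fin 3 → _) k)) :
    rowMinor A B C i = betaDiag ((pairingMatrix (ochiaiMatrix A B C) k).submatrix
      i.succAbove i.succAbove) r := by
  set U : Matrix (Fin 5) (Fin 5) R := (betaMatrix A B C).submatrix i.succAbove id with hU
  have hX : IsAlternating ((![A, B, C] : Fin 3 → Matrix (Fin 5) (Fin 5) R) k) := by
    fin_cases k <;> assumption
  rw [rowMinor_eq_det_betaMatrix, ← hU, ← betaDiag_conj_apply_of_row_eq hX U r hr]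
  congr 2
  ext a b
  rw [submatrix_apply, ← bracket_betaMatrix hA hB hC, conj_apply_eq_bracket]
  rfl

theorem ochiaiMatrix_isSymm (A B C : Matrix (Fin 5) (Fin 5) R) : (ochiaiMatrix A B C).IsSymm := by
  ext i j
  fin_cases i <;> fin_cases j <;> rfl

theorem adjugate_ochiaiMatrix {A B C : Matrix (Fin 5) (Fin 5) R} (hA : IsAlternating A)
    (hB : IsAlternating B) (hC : IsAlternating C) :
    (ochiaiMatrix A B C).adjugate = gramMatrix A B C := by
  have hs := ochiaiMatrix_isSymm A B C
  -- A form is needed whose own vector survives the deletion: `B`, in position 1, when row 0 or 1 is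
  -- removed, and `A`, in position 0, otherwise.
  have h0 := rowMinor_eq_pairing hA hB hC 0 1 1 rfl
  have h1 := rowMinor_eq_pairing hA hB hC 1 1 1 rfl
  have h2 := rowMinor_eq_pairing hA hB hC 2 0 0 rfl
  have h3 := rowMinor_eq_pairing hA hB hC 3 0 0 rfl
  have h4 := rowMinor_eq_pairing hA hB hC 4 0 0 rfl
  have h5 := rowMinor_eq_pairing hA hB hC 5 0 0 rfl
  rw [gramMatrix, h0, h1, h2, h3, h4, h5]
  have s01 := hs.apply 0 1
  have s02 := hs.apply 0 2
  have s12 := hs.apply 1 2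
  generalize ochiaiMatrix A B C = P at *
  rw [adjugate_fin_three]
  ext i j
  fin_cases i <;> fin_cases j <;>
    simp [betaDiag_explicit, pairingMatrix, Fin.succAbove, Fin.lt_def, s01, s02, s12] <;> ring

end Covariance

/-! ### Change of basis in R³ -/

section Change

variable {R : Type*} [CommRing R]

theorem bracket_sum_sum_sum {ι κ : Type*} [Fintype ι] [Fintype κ] (p q : ι → R) (t : κ → R)
    (U : Matrix ι (Fin 5) R) (X : κ → Matrix (Fin 5) (Fin 5) R) :
    bracket (∑ i, p i • U i) (∑ k, t k • X k) (∑ j, q j • U j) =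
      ∑ k, ∑ i, ∑ j, t k * p i * q j * bracket (U i) (X k) (U j) := by
  have hl : ∀ (Y : Matrix (Fin 5) (Fin 5) R) (η : Fin 5 → R),
      bracket (∑ i, p i • U i) Y η = ∑ i, p i * bracket (U i) Y η := by
    intro Y η
    rw [bracket_eq_dotProduct, sum_dotProduct]
    simp only [smul_dotProduct, bracket_eq_dotProduct, smul_eq_mul]
  have hr : ∀ (Y : Matrix (Fin 5) (Fin 5) R) (ξ : Fin 5 → R),
      bracket ξ Y (∑ j, q j • U j) = ∑ j, q j * bracket ξ Y (U j) := by
    intro Y ξ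
    rw [bracket_eq_dotProduct, dotProduct_mulVec, dotProduct_sum]
    simp only [dotProduct_smul, ← dotProduct_mulVec, bracket_eq_dotProduct, smul_eq_mul]
  have hm : ∀ ξ η : Fin 5 → R,
      bracket ξ (∑ k, t k • X k) η = ∑ k, t k * bracket ξ (X k) η := by
    intro ξ η
    rw [bracket_eq_dotProduct, Matrix.sum_mulVec, dotProduct_sum]
    simp only [Matrix.smul_mulVec, dotProduct_smul, bracket_eq_dotProduct, smul_eq_mul]
  rw [hm]
  simp only [hl, hr, Finset.mul_sum, mul_assoc]

/-- The product of two linear forms on the net, in the order of the rows of `pfMatrix`. -/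
def polarCoeff (s t : Fin 3 → R) : Fin 6 → R :=
  ![2 * s 0 * t 0, s 1 * t 2 + s 2 * t 1, 2 * s 1 * t 1, s 2 * t 0 + s 0 * t 2, 2 * s 2 * t 2,
    s 0 * t 1 + s 1 * t 0]

/-- The square of a linear form on the net, in the order of the rows of `pfMatrix`. -/
def squareCoeff (t : Fin 3 → R) : Fin 6 → R :=
  ![t 0 ^ 2, t 1 * t 2, t 1 ^ 2, t 2 * t 0, t 2 ^ 2, t 0 * t 1]

theorem betaPolar_sum_smul (X : Fin 3 → Matrix (Fin 5) (Fin 5) R) (s t : Fin 3 → R) :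
    betaPolar (∑ k, s k • X k) (∑ k, t k • X k) =
      ∑ i, polarCoeff s t i • betaMatrix (X 0) (X 1) (X 2) i := by
  simp only [Fin.sum_univ_three, betaPolar_add_left, betaPolar_add_right, betaPolar_smul_left,
    betaPolar_smul_right, betaPolar_self, betaPolar_comm (X 1) (X 0), betaPolar_comm (X 0) (X 2),
    betaPolar_comm (X 2) (X 1)]
  ext j
  simp [Fin.sum_univ_succ, betaMatrix, polarCoeff]
  ring

theorem betaDiag_sum_smul (X : Fin 3 → Matrix (Fin 5) (Fin 5) R) (t : Fin 3 → R) :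
    betaDiag (∑ k, t k • X k) = ∑ i, squareCoeff t i • betaMatrix (X 0) (X 1) (X 2) i := by
  simp only [Fin.sum_univ_three, betaDiag_add, betaDiag_smul, betaPolar_add_left,
    betaPolar_smul_left, betaPolar_smul_right, betaPolar_comm (X 0) (X 2)]
  ext j
  simp [Fin.sum_univ_succ, betaMatrix, squareCoeff]
  ring

theorem IsAlternating.sum_smul {ι κ : Type*} [Fintype κ] {X : κ → Matrix ι ι R}
    (hX : ∀ k, IsAlternating (X k)) (t : κ → R) : IsAlternating (∑ k, t k • X k) :=
  ⟨fun i => by simp [Matrix.sum_apply, (hX _).1],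
    fun i j => by simp [Matrix.sum_apply, (hX _).2 i j]⟩

theorem bracket_betaMatrix_net {X : Fin 3 → Matrix (Fin 5) (Fin 5) R}
    (hX : ∀ k, IsAlternating (X k)) (k : Fin 3) (i j : Fin 6) :
    bracket (betaMatrix (X 0) (X 1) (X 2) i) (X k) (betaMatrix (X 0) (X 1) (X 2) j) =
      pairingMatrix (ochiaiMatrix (X 0) (X 1) (X 2)) k i j := by
  rw [← bracket_betaMatrix (hX 0) (hX 1) (hX 2)]
  fin_cases k <;> rfl

-- The β-vectors of the new net are quadratic combinations of the six old ones, so by trilinearity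
-- the table rewrites every new entry in `h` and P'. A polynomial identity results, valid for
-- singular `h` too.
set_option maxHeartbeats 4000000 in
theorem ochiaiMatrix_sum_smul {X : Fin 3 → Matrix (Fin 5) (Fin 5) R}
    (hX : ∀ k, IsAlternating (X k)) (h : Matrix (Fin 3) (Fin 3) R) :
    ochiaiMatrix (∑ k, h 0 k • X k) (∑ k, h 1 k • X k) (∑ k, h 2 k • X k) =
      h.det • (h * ochiaiMatrix (X 0) (X 1) (X 2) * hᵀ) := by
  have hs := ochiaiMatrix_isSymm (X 0) (X 1) (X 2)
  have s01 := hs.apply 0 1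
  have s02 := hs.apply 0 2
  have s12 := hs.apply 1 2
  have hp := bracket_betaMatrix_net hX
  generalize ochiaiMatrix (X 0) (X 1) (X 2) = P at *
  simp only [ochiaiMatrix, betaDiag_sum_smul, betaPolar_sum_smul, bracket_sum_sum_sum, hp]
  ext i j
  simp only [Matrix.smul_apply, Matrix.mul_apply, Fin.sum_univ_three, det_fin_three, smul_eq_mul,
    transpose_apply]
  fin_cases i <;> fin_cases j <;>
    simp [Fin.sum_univ_succ, polarCoeff, squareCoeff, pairingMatrix, s01, s02, s12] <;> ring

theorem det_ochiaiMatrix_sum_smul {X : Fin 3 → Matrix (Fin 5) (Fin 5) R}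
    (hX : ∀ k, IsAlternating (X k)) (h : Matrix (Fin 3) (Fin 3) R) :
    (ochiaiMatrix (∑ k, h 0 k • X k) (∑ k, h 1 k • X k) (∑ k, h 2 k • X k)).det =
      h.det ^ 5 * (ochiaiMatrix (X 0) (X 1) (X 2)).det := by
  rw [ochiaiMatrix_sum_smul hX, det_smul, det_mul, det_mul, det_transpose, Fintype.card_fin]
  ring

theorem det_ochiaiMatrix_conj {A B C : Matrix (Fin 5) (Fin 5) R} (hA : IsAlternating A)
    (hB : IsAlternating B) (hC : IsAlternating C) (U : Matrix (Fin 5) (Fin 5) R) :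
    (ochiaiMatrix (U * A * Uᵀ) (U * B * Uᵀ) (U * C * Uᵀ)).det =
      U.det ^ 6 * (ochiaiMatrix A B C).det := by
  rw [ochiaiMatrix_conj hA hB hC, det_smul, Fintype.card_fin]
  ring

end Change

/-! ### Compatibility with ring homomorphisms -/

section Map

variable {R S : Type*} [CommRing R] [CommRing S] (f : R →+* S)

theorem map_betaDiag (X : Matrix (Fin 5) (Fin 5) R) (j : Fin 5) :
    f (betaDiag X j) = betaDiag (X.map f) j := by
  fin_cases j <;> simp [betaDiag_explicit]

theorem map_betaPolar (X Y : Matrix (Fin 5) (Fin 5) R) (j : Fin 5) :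
    f (betaPolar X Y j) = betaPolar (X.map f) (Y.map f) j := by
  rw [betaPolar_apply, betaPolar_apply, map_sub, map_sub, map_betaDiag, map_betaDiag,
    map_betaDiag, Matrix.map_add f (map_add f)]

theorem map_bracket (ξ : Fin 5 → R) (X : Matrix (Fin 5) (Fin 5) R) (η : Fin 5 → R) :
    f (bracket ξ X η) = bracket (fun i => f (ξ i)) (X.map f) (fun i => f (η i)) := by
  simp [bracket]

theorem map_ochiaiMatrix (A B C : Matrix (Fin 5) (Fin 5) R) :
    (ochiaiMatrix A B C).map f = ochiaiMatrix (A.map f) (B.map f) (C.map f) := by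
  ext i j
  fin_cases i <;> fin_cases j <;>
    simp [ochiaiMatrix, map_bracket, map_betaDiag, map_betaPolar]

end Map

/-! ### The universal polynomial F: specialization, multidegree, nonvanishing -/

section Invariant

theorem aeval_netInvariant {R : Type*} [CommRing R] {X : Fin 3 → Matrix (Fin 5) (Fin 5) R}
    (hX : ∀ k, IsAlternating (X k)) :
    aeval (fun v : Var => X v.1 v.2.1.1 v.2.1.2) netInvariant =
      (ochiaiMatrix (X 0) (X 1) (X 2)).det := by
  set f : MvPolynomial Var ℤ →+* R :=
    (aeval fun v : Var => X v.1 v.2.1.1 v.2.1.2).toRingHom with hf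
  have h : ∀ k, (genericAlt k).map f = X k := by
    intro k
    ext i j
    rw [map_apply, genericAlt]
    split_ifs with h1 h2
    · simp [hf]
    · simp [hf, (hX k).2 j i]
    · obtain rfl : i = j := le_antisymm (not_lt.mp h2) (not_lt.mp h1)
      rw [map_zero, (hX k).1]
  change f netInvariant = _
  rw [netInvariant, RingHom.map_det, RingHom.mapMatrix_apply, map_ochiaiMatrix, h, h, h]

/-- The weight recording the degree in each of the three sets of variables. -/
abbrev multiWeight : Var → Fin 3 → ℕ := fun v => Pi.single v.1 1

theorem isWeightedHomogeneous_genericAlt (k : Fin 3) (i j : Fin 5) :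
    IsWeightedHomogeneous multiWeight (genericAlt k i j) (Pi.single k 1) := by
  rw [genericAlt]
  split_ifs with h1 h2
  · exact isWeightedHomogeneous_X ℤ multiWeight _
  · exact (weightedHomogeneousSubmodule ℤ multiWeight _).neg_mem
      (isWeightedHomogeneous_X ℤ multiWeight (k, ⟨(j, i), h2⟩))
  · exact isWeightedHomogeneous_zero ℤ multiWeight _

theorem isWeightedHomogeneous_sub {σ M : Type*} [AddCommMonoid M] {w : σ → M}
    {p q : MvPolynomial σ ℤ} {m : M} (hp : IsWeightedHomogeneous w p m)
    (hq : IsWeightedHomogeneous w q m) : IsWeightedHomogeneous w (p - q) m :=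
  (weightedHomogeneousSubmodule ℤ w m).sub_mem hp hq

theorem isWeightedHomogeneous_neg {σ M : Type*} [AddCommMonoid M] {w : σ → M}
    {p : MvPolynomial σ ℤ} {m : M} (hp : IsWeightedHomogeneous w p m) :
    IsWeightedHomogeneous w (-p) m :=
  (weightedHomogeneousSubmodule ℤ w m).neg_mem hp

theorem isWeightedHomogeneous_betaDiag (k : Fin 3) (j : Fin 5) :
    IsWeightedHomogeneous multiWeight (betaDiag (genericAlt k) j) (2 • Pi.single k 1) := by
  have h : ∀ a b c d, IsWeightedHomogeneous multiWeight (genericAlt k a b * genericAlt k c d)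
      (2 • Pi.single k 1) := by
    intro a b c d
    rw [two_smul]
    exact (isWeightedHomogeneous_genericAlt k a b).mul (isWeightedHomogeneous_genericAlt k c d)
  have h' : ∀ a b c d a' b' c' d' a'' b'' c'' d'', IsWeightedHomogeneous multiWeight
      (genericAlt k a b * genericAlt k c d - genericAlt k a' b' * genericAlt k c' d' +
        genericAlt k a'' b'' * genericAlt k c'' d'') (2 • Pi.single k 1) :=
    fun _ _ _ _ _ _ _ _ _ _ _ _ => (isWeightedHomogeneous_sub (h _ _ _ _) (h _ _ _ _)).add
      (h _ _ _ _)
  rw [betaDiag_explicit]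
  fin_cases j
  · exact h' _ _ _ _ _ _ _ _ _ _ _ _
  · exact isWeightedHomogeneous_neg (h' _ _ _ _ _ _ _ _ _ _ _ _)
  · exact h' _ _ _ _ _ _ _ _ _ _ _ _
  · exact isWeightedHomogeneous_neg (h' _ _ _ _ _ _ _ _ _ _ _ _)
  · exact h' _ _ _ _ _ _ _ _ _ _ _ _

theorem betaPolar_explicit {R : Type*} [CommRing R] (X Y : Matrix (Fin 5) (Fin 5) R) :
    betaPolar X Y =
    ![(X 1 2 * Y 3 4 + Y 1 2 * X 3 4) - (X 1 3 * Y 2 4 + Y 1 3 * X 2 4)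
        + (X 1 4 * Y 2 3 + Y 1 4 * X 2 3),
      -((X 0 2 * Y 3 4 + Y 0 2 * X 3 4) - (X 0 3 * Y 2 4 + Y 0 3 * X 2 4)
        + (X 0 4 * Y 2 3 + Y 0 4 * X 2 3)),
      (X 0 1 * Y 3 4 + Y 0 1 * X 3 4) - (X 0 3 * Y 1 4 + Y 0 3 * X 1 4)
        + (X 0 4 * Y 1 3 + Y 0 4 * X 1 3),
      -((X 0 1 * Y 2 4 + Y 0 1 * X 2 4) - (X 0 2 * Y 1 4 + Y 0 2 * X 1 4)
        + (X 0 4 * Y 1 2 + Y 0 4 * X 1 2)),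
      (X 0 1 * Y 2 3 + Y 0 1 * X 2 3) - (X 0 2 * Y 1 3 + Y 0 2 * X 1 3)
        + (X 0 3 * Y 1 2 + Y 0 3 * X 1 2)] := by
  ext j
  fin_cases j <;> simp [betaPolar_apply, betaDiag_explicit] <;> ring

theorem isWeightedHomogeneous_betaPolar (k l : Fin 3) (j : Fin 5) :
    IsWeightedHomogeneous multiWeight (betaPolar (genericAlt k) (genericAlt l) j)
      (Pi.single k 1 + Pi.single l 1) := by
  have h : ∀ a b c d, IsWeightedHomogeneous multiWeight
      (genericAlt k a b * genericAlt l c d + genericAlt l a b * genericAlt k c d)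
      (Pi.single k 1 + Pi.single l 1) := by
    intro a b c d
    refine ((isWeightedHomogeneous_genericAlt k a b).mul
      (isWeightedHomogeneous_genericAlt l c d)).add ?_
    rw [add_comm]
    exact (isWeightedHomogeneous_genericAlt l a b).mul (isWeightedHomogeneous_genericAlt k c d)
  rw [betaPolar_explicit]
  fin_cases j
  · exact (isWeightedHomogeneous_sub (h _ _ _ _) (h _ _ _ _)).add (h _ _ _ _)
  · exact isWeightedHomogeneous_neg
      ((isWeightedHomogeneous_sub (h _ _ _ _) (h _ _ _ _)).add (h _ _ _ _))
  · exact (isWeightedHomogeneous_sub (h _ _ _ _) (h _ _ _ _)).add (h _ _ _ _)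
  · exact isWeightedHomogeneous_neg
      ((isWeightedHomogeneous_sub (h _ _ _ _) (h _ _ _ _)).add (h _ _ _ _))
  · exact (isWeightedHomogeneous_sub (h _ _ _ _) (h _ _ _ _)).add (h _ _ _ _)

theorem isWeightedHomogeneous_bracket {ξ η : Fin 5 → MvPolynomial Var ℤ} {m n : Fin 3 → ℕ}
    (hξ : ∀ i, IsWeightedHomogeneous multiWeight (ξ i) m)
    (hη : ∀ i, IsWeightedHomogeneous multiWeight (η i) n) (k : Fin 3) :
    IsWeightedHomogeneous multiWeight (bracket ξ (genericAlt k) η) (m + Pi.single k 1 + n) :=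
  IsWeightedHomogeneous.sum _ _ _ fun i _ => IsWeightedHomogeneous.sum _ _ _ fun j _ =>
    ((hξ i).mul (isWeightedHomogeneous_genericAlt k i j)).mul (hη j)

/-- With these weights every term of the Leibniz expansion of det P' has weight 3 · (1,1,1) + 2 ·
(1,1,1). -/
theorem isWeightedHomogeneous_ochiaiMatrix (i j : Fin 3) :
    IsWeightedHomogeneous multiWeight
      (ochiaiMatrix (genericAlt 0) (genericAlt 1) (genericAlt 2) i j)
      ((fun _ => 1) + Pi.single i 1 + Pi.single j 1) := by
  have e : ∀ {p : MvPolynomial Var ℤ} {m n : Fin 3 → ℕ}, IsWeightedHomogeneous multiWeight p m →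
      m = n → IsWeightedHomogeneous multiWeight p n := fun h e => e ▸ h
  have dd : ∀ (a b c : Fin 3) (n : Fin 3 → ℕ),
      2 • Pi.single a 1 + Pi.single b 1 + 2 • Pi.single c 1 = n →
      IsWeightedHomogeneous multiWeight
        (bracket (betaDiag (genericAlt a)) (genericAlt b) (betaDiag (genericAlt c))) n :=
    fun a b c n => e (isWeightedHomogeneous_bracket (isWeightedHomogeneous_betaDiag a)
      (isWeightedHomogeneous_betaDiag c) b)
  have dp : ∀ (a b c d : Fin 3) (n : Fin 3 → ℕ),
      2 • Pi.single a 1 + Pi.single b 1 + (Pi.single c 1 + Pi.single d 1) = n →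
      IsWeightedHomogeneous multiWeight
        (bracket (betaDiag (genericAlt a)) (genericAlt b)
          (betaPolar (genericAlt c) (genericAlt d))) n :=
    fun a b c d n => e (isWeightedHomogeneous_bracket (isWeightedHomogeneous_betaDiag a)
      (isWeightedHomogeneous_betaPolar c d) b)
  fin_cases i <;> fin_cases j
  · exact dp 0 2 0 1 _ (by decide)
  · exact dd 0 2 1 _ (by decide)
  · exact dd 2 1 0 _ (by decide)
  · exact dd 0 2 1 _ (by decide)
  · exact dp 1 0 1 2 _ (by decide)
  · exact dd 1 0 2 _ (by decide)
  · exact dd 2 1 0 _ (by decide)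
  · exact dd 1 0 2 _ (by decide)
  · exact dp 2 1 2 0 _ (by decide)

theorem isWeightedHomogeneous_netInvariant :
    IsWeightedHomogeneous multiWeight netInvariant (fun _ => 5) := by
  rw [netInvariant, det_apply]
  refine IsWeightedHomogeneous.sum _ _ _ fun σ _ => ?_
  have h : IsWeightedHomogeneous multiWeight
      (∏ i, ochiaiMatrix (genericAlt 0) (genericAlt 1) (genericAlt 2) (σ i) i) (fun _ => 5) := by
    have := IsWeightedHomogeneous.prod Finset.univ _ _
      fun i _ => isWeightedHomogeneous_ochiaiMatrix (σ i) i
    have hw : ∀ σ : Equiv.Perm (Fin 3), ∑ i,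
        ((fun _ => 1) + Pi.single (σ i) 1 + Pi.single i 1 : Fin 3 → ℕ) = fun _ => 5 := by
      decide
    rwa [hw] at this
  rw [Units.smul_def]
  exact (weightedHomogeneousSubmodule ℤ multiWeight _).smul_mem _ h

theorem netInvariant_ne_zero : netInvariant ≠ 0 := by
  -- A sparse integral net, two basis 2-forms in each member, with F = 1.
  let X : Fin 3 → Matrix (Fin 5) (Fin 5) ℤ :=
    ![altOf !![0, 0, 0, 1, 0; 0, 0, 0, 0, 0; 0, 0, 0, 0, 1; 0, 0, 0, 0, 0; 0, 0, 0, 0, 0],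
      altOf !![0, 1, 0, 0, 0; 0, 0, 0, 0, 0; 0, 0, 0, 0, 0; 0, 0, 0, 0, 1; 0, 0, 0, 0, 0],
      altOf !![0, 0, 0, 0, 1; 0, 0, 1, 0, 0; 0, 0, 0, 0, 0; 0, 0, 0, 0, 0; 0, 0, 0, 0, 0]]
  have hX : ∀ k, IsAlternating (X k) := fun k => by
    fin_cases k <;> exact isAlternating_altOf _
  intro h
  have h1 := aeval_netInvariant hX
  rw [h, map_zero] at h1
  have hP : ochiaiMatrix (X 0) (X 1) (X 2) = !![0, 1, 0; 1, 0, 0; 0, 0, -1] := by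
    ext i j
    fin_cases i <;> fin_cases j <;>
      simp [ochiaiMatrix, bracket, betaDiag_explicit, betaPolar_explicit, X, altOf,
        Fin.sum_univ_five]
  rw [hP, det_fin_three] at h1
  simp at h1

end Invariant

/-! ### From the linear map ν to its three matrices -/

section NetMatrices

variable {R : Type u} [CommRing R] (ν : ⋀[R]^2 (Fin 5 → R) →ₗ[R] (Fin 3 → R))

/-- The `k`-th coordinate of `ν (x ∧ y)`, as a bilinear form. -/
def netForm (k : Fin 3) : (Fin 5 → R) →ₗ[R] (Fin 5 → R) →ₗ[R] R :=
  LinearMap.mk₂ R (fun x y => ν (exteriorPower.ιMulti R 2 ![x, y]) k)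
    (fun x x' y => by
      have h := (exteriorPower.ιMulti R 2 (M := Fin 5 → R)).map_vecCons_add ![y] x x'
      rw [h, map_add, Pi.add_apply])
    (fun c x y => by
      have h := (exteriorPower.ιMulti R 2 (M := Fin 5 → R)).map_vecCons_smul ![y] c x
      rw [h, map_smul, Pi.smul_apply])
    (fun x y y' => by
      have h := (exteriorPower.ιMulti R 2 (M := Fin 5 → R)).map_update_add ![x, 0] 1 y y'
      have e : ∀ z, Function.update ![x, 0] 1 z = ![x, z] := fun z => by
        ext i
        fin_cases i <;> rfl
      rw [e, e, e] at h
      rw [h, map_add, Pi.add_apply])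
    (fun c x y => by
      have h := (exteriorPower.ιMulti R 2 (M := Fin 5 → R)).map_update_smul ![x, 0] 1 c y
      have e : ∀ z, Function.update ![x, 0] 1 z = ![x, z] := fun z => by
        ext i
        fin_cases i <;> rfl
      rw [e, e] at h
      rw [h, map_smul, Pi.smul_apply])

theorem apply_ιMulti_eq_bracket (k : Fin 3) (x y : Fin 5 → R) :
    ν (exteriorPower.ιMulti R 2 ![x, y]) k = bracket x (netMatrix ν k) y := by
  change netForm ν k x y = _
  rw [← Matrix.toLinearMap₂'_toMatrix' (R := R) (netForm ν k), Matrix.toLinearMap₂'_apply]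
  refine Finset.sum_congr rfl fun i _ => Finset.sum_congr rfl fun j _ => ?_
  rw [LinearMap.toMatrix₂'_apply]
  simp only [netForm, LinearMap.mk₂_apply, netMatrix, smul_eq_mul]
  ring

theorem isAlternating_netMatrix (k : Fin 3) : IsAlternating (netMatrix ν k) := by
  refine ⟨fun i => ?_, fun i j => ?_⟩
  · have h := (exteriorPower.ιMulti R 2 (M := Fin 5 → R)).map_eq_zero_of_eq
      ![Pi.single i 1, Pi.single i 1] (i := 0) (j := 1) rfl (by decide)
    rw [netMatrix, h, map_zero, Pi.zero_apply]
  · have h := (exteriorPower.ιMulti R 2 (M := Fin 5 → R)).map_swap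
      ![Pi.single i 1, Pi.single j 1] (i := 0) (j := 1) (by decide)
    have e : ![Pi.single i 1, Pi.single j 1] ∘ Equiv.swap (0 : Fin 2) 1 =
        ![(Pi.single j 1 : Fin 5 → R), Pi.single i 1] := by
      ext a
      fin_cases a <;> simp
    rw [e] at h
    rw [netMatrix, netMatrix, h, map_neg, Pi.neg_apply]

theorem evalNet_netInvariant : evalNet ν netInvariant = (netOchiai ν).det :=
  aeval_netInvariant (isAlternating_netMatrix ν)

theorem netMatrix_comp (g : (Fin 5 → R) →ₗ[R] (Fin 5 → R)) (h : (Fin 3 → R) →ₗ[R] (Fin 3 → R))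
    (k : Fin 3) :
    netMatrix (h ∘ₗ ν ∘ₗ exteriorPower.map 2 g) k =
      ∑ l, LinearMap.toMatrix' h k l •
        ((LinearMap.toMatrix' g)ᵀ * netMatrix ν l * (LinearMap.toMatrix' g)ᵀᵀ) := by
  ext i j
  rw [netMatrix, LinearMap.comp_apply, LinearMap.comp_apply, exteriorPower.map_apply_ιMulti,
    ← LinearMap.toMatrix'_mulVec h, Matrix.mulVec, dotProduct, Matrix.sum_apply]
  refine Finset.sum_congr rfl fun l _ => ?_
  have e : g ∘ ![Pi.single i 1, Pi.single j 1] = ![g (Pi.single i 1), g (Pi.single j 1)] := by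
    ext a
    fin_cases a <;> rfl
  rw [e, apply_ιMulti_eq_bracket, Matrix.smul_apply, conj_apply_eq_bracket, smul_eq_mul]
  rfl

theorem evalNet_comp (g : (Fin 5 → R) →ₗ[R] (Fin 5 → R)) (h : (Fin 3 → R) →ₗ[R] (Fin 3 → R)) :
    evalNet (h ∘ₗ ν ∘ₗ exteriorPower.map 2 g) netInvariant =
      LinearMap.det g ^ 6 * LinearMap.det h ^ 5 * evalNet ν netInvariant := by
  have hν := isAlternating_netMatrix ν
  rw [evalNet_netInvariant, evalNet_netInvariant, netOchiai, netMatrix_comp, netMatrix_comp,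
    netMatrix_comp, det_ochiaiMatrix_sum_smul fun k => (hν k).conj _,
    det_ochiaiMatrix_conj (hν 0) (hν 1) (hν 2), det_transpose, LinearMap.det_toMatrix',
    LinearMap.det_toMatrix', netOchiai]
  ring

theorem adjugate_netOchiai : (netOchiai ν).adjugate = netGram ν :=
  adjugate_ochiaiMatrix (isAlternating_netMatrix ν 0) (isAlternating_netMatrix ν 1)
    (isAlternating_netMatrix ν 2)

theorem det_netGram : (netGram ν).det = evalNet ν netInvariant ^ 2 := by
  rw [← adjugate_netOchiai, det_adjugate, Fintype.card_fin, evalNet_netInvariant]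

end NetMatrices

/-! ### The form with Gram matrix Q as cokernel of G_ν -/

section Cokernel

variable {R : Type u} [CommRing R]

/-- The exponents of the quadratic monomials, in the order of the rows of `pfMatrix`. -/
def quadExponent : Fin 6 → Fin 3 →₀ ℕ :=
  ![.single 0 1 + .single 0 1, .single 1 1 + .single 2 1, .single 1 1 + .single 1 1,
    .single 0 1 + .single 2 1, .single 2 1 + .single 2 1, .single 0 1 + .single 1 1]

/-- The coefficients of a quadratic form, in the order of the rows of `pfMatrix`. -/
def quadCoeff (R : Type u) [CommRing R] : SymSq R →ₗ[R] Fin 6 → R :=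
  (LinearMap.pi fun i => lcoeff R (quadExponent i)).comp (SymSq R).subtype

theorem quadCoeff_apply (s : SymSq R) (i : Fin 6) :
    quadCoeff R s i = coeff (quadExponent i) (s : MvPolynomial (Fin 3) R) := rfl

theorem exists_quadExponent_eq {d : Fin 3 →₀ ℕ} (hd : d.degree = 2) :
    ∃ i, quadExponent i = d := by
  rw [Finsupp.degree_eq_sum, Fin.sum_univ_three] at hd
  have h : (d 0 = 2 ∧ d 1 = 0 ∧ d 2 = 0) ∨ (d 0 = 0 ∧ d 1 = 1 ∧ d 2 = 1) ∨
      (d 0 = 0 ∧ d 1 = 2 ∧ d 2 = 0) ∨ (d 0 = 1 ∧ d 1 = 0 ∧ d 2 = 1) ∨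
      (d 0 = 0 ∧ d 1 = 0 ∧ d 2 = 2) ∨ (d 0 = 1 ∧ d 1 = 1 ∧ d 2 = 0) := by omega
  rcases h with h | h | h | h | h | h
  · exact ⟨0, by ext k; fin_cases k <;> simp [quadExponent, h]⟩
  · exact ⟨1, by ext k; fin_cases k <;> simp [quadExponent, h]⟩
  · exact ⟨2, by ext k; fin_cases k <;> simp [quadExponent, h]⟩
  · exact ⟨3, by ext k; fin_cases k <;> simp [quadExponent, h]⟩
  · exact ⟨4, by ext k; fin_cases k <;> simp [quadExponent, h]⟩
  · exact ⟨5, by ext k; fin_cases k <;> simp [quadExponent, h]⟩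

theorem quadCoeff_injective : Function.Injective (quadCoeff R) := by
  rw [injective_iff_map_eq_zero]
  intro s hs
  ext d
  by_cases hd : d.degree = 2
  · obtain ⟨i, rfl⟩ := exists_quadExponent_eq hd
    exact congrFun hs i
  · exact (show IsHomogeneous _ 2 from s.2).coeff_eq_zero hd

theorem quadExponent_injective : Function.Injective quadExponent := by
  intro i j h
  have h0 := DFunLike.congr_fun h 0
  have h1 := DFunLike.congr_fun h 1
  fin_cases i <;> fin_cases j <;> simp [quadExponent] at h0 h1 ⊢

theorem coeff_mul_linForm (p q : Fin 3 → R) (i : Fin 6) :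
    coeff (quadExponent i) (toLinForm R p * toLinForm R q) =
      ![p 0 * q 0, p 1 * q 2 + p 2 * q 1, p 1 * q 1, p 2 * q 0 + p 0 * q 2, p 2 * q 2,
        p 0 * q 1 + p 1 * q 0] i := by
  have h : toLinForm R p * toLinForm R q =
      monomial (quadExponent 0) (p 0 * q 0) + monomial (quadExponent 1) (p 1 * q 2 + p 2 * q 1) +
      monomial (quadExponent 2) (p 1 * q 1) + monomial (quadExponent 3) (p 2 * q 0 + p 0 * q 2) +
      monomial (quadExponent 4) (p 2 * q 2) + monomial (quadExponent 5) (p 0 * q 1 + p 1 * q 0) := by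
    have e : ∀ (a b : Fin 3) (c : R),
        monomial (Finsupp.single a 1 + Finsupp.single b 1) c = C c * (X a * X b) := by
      intro a b c
      rw [X, X, monomial_mul, C_mul_monomial, mul_one, mul_one]
    simp only [toLinForm, Fintype.linearCombination_apply, Fin.sum_univ_three, quadExponent,
      smul_eq_C_mul]
    simp [e]
    ring
  rw [h]
  simp only [coeff_add, coeff_monomial, quadExponent_injective.eq_iff]
  fin_cases i <;> simp

/-- The polarization of the Pfaffian of `4 × 4` matrices. -/
def pf4Polar (X Y : Matrix (Fin 4) (Fin 4) R) : R := pf4 (X + Y) - pf4 X - pf4 Y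

theorem symForm_apply (A B C : Matrix (Fin 5) (Fin 5) R) (s : SymSq R) :
    symForm (gramMatrix A B C) s =
      ∑ i : Fin 6, (-1) ^ (i : ℕ) * rowMinor A B C i * quadCoeff R s i := by
  have h0 : Finset.Ici (0 : Fin 3) = {0, 1, 2} := by decide
  have h1 : Finset.Ici (1 : Fin 3) = {1, 2} := by decide
  have h2 : Finset.Ici (2 : Fin 3) = {2} := by decide
  simp only [symForm, LinearMap.comp_apply, Submodule.subtype_apply,
    Fin.sum_univ_three, h0, h1, h2]
  simp [quadCoeff_apply, Fin.sum_univ_succ, quadExponent, gramMatrix, lcoeff_apply]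
  ring

theorem sum_rowMinor_mul (A B C : Matrix (Fin 5) (Fin 5) R) (s : Fin 6 → R) :
    ∑ i : Fin 6, (-1) ^ (i : ℕ) * rowMinor A B C i * s i =
      Matrix.det (Matrix.of fun i => (Fin.cons (s i) (pfMatrix A B C i) : Fin 6 → R)) := by
  rw [det_succ_column_zero]
  refine Finset.sum_congr rfl fun i _ => ?_
  rw [Matrix.of_apply, Fin.cons_zero, mul_right_comm]
  rfl

theorem sum_rowMinor_mul_mulVec (A B C : Matrix (Fin 5) (Fin 5) R) (w : Fin 5 → R) :
    ∑ i : Fin 6, (-1) ^ (i : ℕ) * rowMinor A B C i * (pfMatrix A B C *ᵥ w) i = 0 := by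
  have h : ∀ j, ∑ i : Fin 6, (-1) ^ (i : ℕ) * rowMinor A B C i * pfMatrix A B C i j = 0 := by
    intro j
    rw [sum_rowMinor_mul A B C fun i => pfMatrix A B C i j]
    exact det_zero_of_column_eq (i := 0) (j := j.succ) (Fin.succ_ne_zero j).symm fun i => rfl
  simp only [Matrix.mulVec, dotProduct, Finset.mul_sum]
  rw [Finset.sum_comm]
  refine Finset.sum_eq_zero fun j _ => ?_
  have := congrArg (· * w j) (h j)
  simpa only [Finset.sum_mul, zero_mul, mul_assoc] using this

/-- Cramer's rule: `N = [s | M]` has determinant 0, so `N * adj N = 0`. Column `i` of this product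
expresses ± the `i`-th minor times `s` through the columns of `M`. -/
theorem exists_rowMinor_smul_eq_mulVec (A B C : Matrix (Fin 5) (Fin 5) R) (s : Fin 6 → R)
    (hs : ∑ i : Fin 6, (-1) ^ (i : ℕ) * rowMinor A B C i * s i = 0) (i : Fin 6) :
    ∃ w, rowMinor A B C i • s = pfMatrix A B C *ᵥ w := by
  rw [sum_rowMinor_mul] at hs
  set N : Matrix (Fin 6) (Fin 6) R :=
    Matrix.of fun i => (Fin.cons (s i) (pfMatrix A B C i) : Fin 6 → R) with hN
  have h0 : N.adjugate 0 i = (-1) ^ (i : ℕ) * rowMinor A B C i := by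
    rw [adjugate_fin_succ_eq_det_submatrix]
    simp only [Fin.val_zero, add_zero]
    rfl
  refine ⟨fun j => -(-1) ^ (i : ℕ) * N.adjugate j.succ i, ?_⟩
  ext r
  have h := congrFun (congrFun (mul_adjugate N) r) i
  rw [hs, zero_smul, Matrix.zero_apply, Matrix.mul_apply, Fin.sum_univ_succ, h0] at h
  have hsq : ((-1 : R) ^ (i : ℕ)) * (-1) ^ (i : ℕ) = 1 := by
    rw [← mul_pow]
    simp
  have e : (pfMatrix A B C *ᵥ fun j => -(-1) ^ (i : ℕ) * N.adjugate j.succ i) r =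
      -(-1) ^ (i : ℕ) * ∑ j : Fin 5, N r j.succ * N.adjugate j.succ i := by
    rw [Matrix.mulVec, dotProduct, Finset.mul_sum]
    refine Finset.sum_congr rfl fun j _ => ?_
    rw [mul_left_comm]
    rfl
  have e0 : N r 0 = s r := rfl
  rw [e0] at h
  rw [e, Pi.smul_apply, smul_eq_mul]
  linear_combination (-1) ^ (i : ℕ) * h - rowMinor A B C i * s r * hsq

/-- Expanding det Q along its first row puts it in the ideal of the minors, which is therefore the
unit ideal. -/
theorem mem_ideal_of_rowMinor_mem {A B C : Matrix (Fin 5) (Fin 5) R} {I : Ideal R}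
    (hI : ∀ i, rowMinor A B C i ∈ I) (hu : IsUnit (gramMatrix A B C).det) (r : R) : r ∈ I := by
  have h : (gramMatrix A B C).det ∈ I := by
    have h0 := hI 0
    have h5 := hI 5
    have h3 := hI 3
    have : (gramMatrix A B C).det =
        (rowMinor A B C 2 * rowMinor A B C 4 - rowMinor A B C 1 * rowMinor A B C 1) *
          rowMinor A B C 0 +
        (-rowMinor A B C 5 * rowMinor A B C 4 + -rowMinor A B C 1 * rowMinor A B C 3) *
          rowMinor A B C 5 +
        (-rowMinor A B C 5 * rowMinor A B C 1 - rowMinor A B C 2 * rowMinor A B C 3) *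
          rowMinor A B C 3 := by
      rw [det_fin_three]
      simp [gramMatrix]
      ring
    rw [this]
    exact I.add_mem (I.add_mem (I.mul_mem_left _ h0) (I.mul_mem_left _ h5)) (I.mul_mem_left _ h3)
  rw [Ideal.eq_top_of_isUnit_mem I h hu]
  trivial

variable (ν : ⋀[R]^2 (Fin 5 → R) →ₗ[R] (Fin 3 → R))

theorem quadCoeff_netSquare (v : Fin 4 → Fin 5 → R) (i : Fin 6) :
    quadCoeff R (netSquare ν (exteriorPower.ιMulti R 4 v)) i =
      (fun A B C : Matrix (Fin 4) (Fin 4) R =>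
        ![pf4 A, pf4Polar B C, pf4 B, pf4Polar C A, pf4 C, pf4Polar A B] i)
        (Matrix.of v * netMatrix ν 0 * (Matrix.of v)ᵀ)
        (Matrix.of v * netMatrix ν 1 * (Matrix.of v)ᵀ)
        (Matrix.of v * netMatrix ν 2 * (Matrix.of v)ᵀ) := by
  have h : ∀ (k : Fin 3) a b, ν (exteriorPower.ιMulti R 2 ![v a, v b]) k =
      (Matrix.of v * netMatrix ν k * (Matrix.of v)ᵀ) a b := by
    intro k a b
    rw [apply_ιMulti_eq_bracket, conj_apply_eq_bracket]
    rfl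
  rw [quadCoeff_apply, netSquare, exteriorPower.alternatingMapLinearEquiv_apply_ιMulti]
  change coeff _ (wedgeForm ν (v 0) (v 1) * wedgeForm ν (v 2) (v 3)
    - wedgeForm ν (v 0) (v 2) * wedgeForm ν (v 1) (v 3)
    + wedgeForm ν (v 0) (v 3) * wedgeForm ν (v 1) (v 2)) = _
  rw [coeff_add, coeff_sub]
  simp only [wedgeForm, coeff_mul_linForm, h]
  fin_cases i <;> simp [pf4, pf4Polar] <;> ring

theorem pf4Polar_conj {X Y : Matrix (Fin 5) (Fin 5) R} (hX : IsAlternating X)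
    (hY : IsAlternating Y) (V : Matrix (Fin 4) (Fin 5) R) :
    pf4Polar (V * X * Vᵀ) (V * Y * Vᵀ) =
      ∑ k, (V.submatrix id k.succAbove).det * pfPolar X Y k := by
  have h : ∀ {Z : Matrix (Fin 5) (Fin 5) R}, IsAlternating Z → pf4 (V * Z * Vᵀ) =
      ∑ k, (V.submatrix id k.succAbove).det * pfMinor Z k := by
    intro Z hZ
    rw [hZ.eq_altOf, pf4_mul_altOf_mul_transpose]
  rw [pf4Polar, ← Matrix.add_mul, ← Matrix.mul_add, h (hX.add hY), h hX, h hY,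
    ← Finset.sum_sub_distrib, ← Finset.sum_sub_distrib]
  refine Finset.sum_congr rfl fun k _ => ?_
  rw [pfPolar]
  ring

/-- The coefficients of G_ν on a decomposable 4-vector are Pfaffians and polarized Pfaffians of the
restricted net; Cauchy–Binet separates them into `M` and the 4 × 4 minors of the vectors. -/
theorem quadCoeff_netSquare_eq_mulVec (v : Fin 4 → Fin 5 → R) :
    quadCoeff R (netSquare ν (exteriorPower.ιMulti R 4 v)) =
      pfMatrix (netMatrix ν 0) (netMatrix ν 1) (netMatrix ν 2) *ᵥ
        fun k => ((Matrix.of v).submatrix id k.succAbove).det := by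
  have hν := isAlternating_netMatrix ν
  have h : ∀ k, pf4 (Matrix.of v * netMatrix ν k * (Matrix.of v)ᵀ) =
      ∑ j, ((Matrix.of v).submatrix id j.succAbove).det * pfMinor (netMatrix ν k) j := by
    intro k
    rw [(hν k).eq_altOf, pf4_mul_altOf_mul_transpose]
  ext i
  rw [quadCoeff_netSquare]
  simp only [h, pf4Polar_conj (hν _) (hν _), Matrix.mulVec, dotProduct, mul_comm]
  fin_cases i <;> rfl

theorem exists_netSquare_quadCoeff (w : Fin 5 → R) :
    ∃ z, quadCoeff R (netSquare ν z) =
      pfMatrix (netMatrix ν 0) (netMatrix ν 1) (netMatrix ν 2) *ᵥ w := by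
  -- The 4-vector omitting `e_j` has `j`-th complementary minor 1 and all others 0, so its image is
  -- column `j` of `M`.
  refine ⟨∑ j, w j • exteriorPower.ιMulti R 4 fun a : Fin 4 => Pi.single (j.succAbove a) 1, ?_⟩
  have h : ∀ j k : Fin 5, Matrix.det ((Matrix.of fun a : Fin 4 =>
      (Pi.single (j.succAbove a) 1 : Fin 5 → R)).submatrix id k.succAbove) =
        if j = k then 1 else 0 := by
    intro j k
    split_ifs with hjk
    · subst hjk
      convert det_one (n := Fin 4) (R := R)
      ext a b
      simp [Pi.single_apply, Matrix.one_apply, Fin.succAbove_right_injective.eq_iff, eq_comm]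
    · obtain ⟨a, ha⟩ := Fin.exists_succAbove_eq (Ne.symm hjk)
      refine det_eq_zero_of_row_eq_zero a fun b => ?_
      simp [ha, Fin.succAbove_ne]
  have hq : ∀ (j : Fin 5) (i : Fin 6), quadCoeff R (netSquare ν (exteriorPower.ιMulti R 4
      fun a : Fin 4 => Pi.single (j.succAbove a) 1)) i =
        pfMatrix (netMatrix ν 0) (netMatrix ν 1) (netMatrix ν 2) i j := by
    intro j i
    rw [quadCoeff_netSquare_eq_mulVec, Matrix.mulVec, dotProduct]
    refine (Finset.sum_congr rfl fun k _ => congrArg _ (h j k)).trans ?_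
    simp
  ext i
  simp [Matrix.mulVec, dotProduct, mul_comm, hq]

theorem symForm_netGram_apply (s : SymSq R) :
    symForm (netGram ν) s = ∑ i : Fin 6, (-1) ^ (i : ℕ) *
      rowMinor (netMatrix ν 0) (netMatrix ν 1) (netMatrix ν 2) i * quadCoeff R s i :=
  symForm_apply _ _ _ s

theorem range_netSquare_le :
    LinearMap.range (netSquare ν) ≤ LinearMap.ker (symForm (netGram ν)) := by
  rw [LinearMap.range_le_ker_iff]
  apply exteriorPower.linearMap_ext
  ext v
  change symForm (netGram ν) (netSquare ν (exteriorPower.ιMulti R 4 v)) = 0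
  rw [symForm_netGram_apply, quadCoeff_netSquare_eq_mulVec, sum_rowMinor_mul_mulVec]

theorem ker_symForm_eq_range_netSquare (hu : IsUnit (netGram ν).det) :
    LinearMap.ker (symForm (netGram ν)) = LinearMap.range (netSquare ν) := by
  refine le_antisymm (fun s hs => ?_) (range_netSquare_le ν)
  rw [LinearMap.mem_ker, symForm_netGram_apply] at hs
  -- The ideal consists of the scalars `r` with `r • s` in the image of G_ν; it contains all maximal
  -- minors, hence 1.
  have h := mem_ideal_of_rowMinor_mem
    (I := (LinearMap.range (netSquare ν)).comap (LinearMap.toSpanSingleton R _ s))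
    (fun i => by
      obtain ⟨w, hw⟩ := exists_rowMinor_smul_eq_mulVec _ _ _ _ hs i
      obtain ⟨z, hz⟩ := exists_netSquare_quadCoeff ν w
      refine ⟨z, quadCoeff_injective ?_⟩
      rw [hz, ← hw, LinearMap.toSpanSingleton_apply, map_smul]) hu 1
  rwa [Submodule.mem_comap, LinearMap.toSpanSingleton_apply, one_smul] at h

theorem symForm_surjective (hu : IsUnit (netGram ν).det) :
    Function.Surjective (symForm (netGram ν)) := by
  intro r
  refine mem_ideal_of_rowMinor_mem (I := LinearMap.range (symForm (netGram ν))) (fun i => ?_) hu r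
  refine ⟨⟨monomial (quadExponent i) ((-1) ^ (i : ℕ)), ?_⟩, ?_⟩
  · refine isHomogeneous_monomial _ ?_
    fin_cases i <;> simp [quadExponent, Finsupp.degree_eq_sum, Fin.sum_univ_three]
  · rw [symForm_netGram_apply]
    simp only [quadCoeff_apply, coeff_monomial, quadExponent_injective.eq_iff]
    have hsq : ((-1 : R) ^ (i : ℕ)) * (-1) ^ (i : ℕ) = 1 := by
      rw [← mul_pow]
      simp
    simp only [mul_ite, mul_zero, Finset.sum_ite_eq, Finset.mem_univ, if_true]
    linear_combination rowMinor (netMatrix ν 0) (netMatrix ν 1) (netMatrix ν 2) i * hsq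

end Cokernel

/-! ### Rank 4 over a field; regular pencils -/

section Field

variable {K : Type*} [Field K]

/-- The Pfaffian vector of `X` spans the kernel of `X`. -/
def HasPfaffianKernel (X : Matrix (Fin 5) (Fin 5) K) : Prop :=
  betaDiag X ≠ 0 ∧ ∀ v, X *ᵥ v = 0 → ∃ c : K, v = c • betaDiag X

/-- Vanishing 4 × 4 Pfaffians are the Plücker relations, so a nonzero entry `X i j` lets `X` factor
through rows `i` and `j`. -/
theorem IsAlternating.rank_le_two_of_betaDiag_eq_zero {X : Matrix (Fin 5) (Fin 5) K}
    (hX : IsAlternating X) (h : betaDiag X = 0) : X.rank ≤ 2 := by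
  have hm : ∀ k, pfMinor X k = 0 := fun k => by
    have := congrFun h k
    rw [betaDiag, Pi.zero_apply] at this
    simpa using this
  have hp : ∀ i j c d, X i j * X c d = X i c * X j d - X i d * X j c := by
    intro i j c d
    have e : ∀ f : Fin 4 → Fin 5, (1 : Matrix (Fin 5) (Fin 5) K).submatrix f id * X *
        ((1 : Matrix (Fin 5) (Fin 5) K).submatrix f id)ᵀ = X.submatrix f f := by
      intro f
      ext a b
      simp [Matrix.mul_apply, Matrix.one_apply]
    have := pf4_mul_altOf_mul_transpose
      ((1 : Matrix (Fin 5) (Fin 5) K).submatrix ![i, j, c, d] id) X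
    rw [← hX.eq_altOf, e] at this
    simp only [hm, mul_zero, Finset.sum_const_zero] at this
    simp [pf4] at this
    linear_combination this
  by_cases h0 : X = 0
  · simp [h0]
  obtain ⟨i, j, hij⟩ : ∃ i j, X i j ≠ 0 := by
    by_contra! hc
    exact h0 (by ext i j; exact hc i j)
  have hf : X = (Matrix.of fun c => ![(X i j)⁻¹ * X i c, -((X i j)⁻¹ * X j c)] :
      Matrix (Fin 5) (Fin 2) K) * (Matrix.of ![fun d => X j d, fun d => X i d]) := by
    ext c d
    simp [Matrix.mul_apply, Fin.sum_univ_two]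
    field_simp
    linear_combination hp i j c d
  rw [hf]
  exact (rank_mul_le_left _ _).trans ((rank_le_card_width _).trans (by simp))

theorem IsAlternating.hasPfaffianKernel_of_rank_eq_four {X : Matrix (Fin 5) (Fin 5) K}
    (hX : IsAlternating X) (h : X.rank = 4) : HasPfaffianKernel X := by
  have h0 : betaDiag X ≠ 0 := fun h0 => by
    have := hX.rank_le_two_of_betaDiag_eq_zero h0
    omega
  refine ⟨h0, fun v hv => ?_⟩
  have hk : Module.finrank K (LinearMap.ker X.mulVecLin) = 1 := by
    have := LinearMap.finrank_range_add_finrank_ker X.mulVecLin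
    rw [Module.finrank_fin_fun] at this
    change X.rank + _ = 5 at this
    omega
  let b : LinearMap.ker X.mulVecLin := ⟨betaDiag X, hX.mulVec_betaDiag⟩
  obtain ⟨c, hc⟩ := (finrank_eq_one_iff_of_nonzero' b fun hb => h0 (congrArg Subtype.val hb)).mp hk
    ⟨v, hv⟩
  exact ⟨c, (congrArg Subtype.val hc).symm⟩

/-- A pencil of alternating forms all of whose nonzero members have rank `4`. -/
structure IsRegularPencil (X Y : Matrix (Fin 5) (Fin 5) K) : Prop where
  left : IsAlternating X
  right : IsAlternating Y
  hasPfaffianKernel : ∀ s t : K, (s ≠ 0 ∨ t ≠ 0) → HasPfaffianKernel (s • X + t • Y)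

theorem IsRegularPencil.symm {X Y : Matrix (Fin 5) (Fin 5) K} (h : IsRegularPencil X Y) :
    IsRegularPencil Y X :=
  ⟨h.right, h.left, fun s t hst => by
    rw [add_comm]
    exact h.hasPfaffianKernel t s hst.symm⟩

theorem IsRegularPencil.hasPfaffianKernel_left {X Y : Matrix (Fin 5) (Fin 5) K}
    (h : IsRegularPencil X Y) : HasPfaffianKernel X := by
  simpa using h.hasPfaffianKernel 1 0 (Or.inl one_ne_zero)

theorem IsRegularPencil.betaDiag_smul_add_ne_zero {X Y : Matrix (Fin 5) (Fin 5) K}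
    (h : IsRegularPencil X Y) (s : K) :
    s ^ 2 • betaDiag X + s • betaPolar X Y + betaDiag Y ≠ 0 := by
  have := (h.hasPfaffianKernel s 1 (Or.inr one_ne_zero)).1
  rwa [one_smul, betaDiag_add, betaDiag_smul, betaPolar_smul_left] at this

theorem HasPfaffianKernel.exists_eq_smul {X : Matrix (Fin 5) (Fin 5) K}
    (h : HasPfaffianKernel X) {v : Fin 5 → K} (hv : v ≠ 0) (hXv : X *ᵥ v = 0) :
    ∃ c : K, c ≠ 0 ∧ betaDiag X = c • v := by
  obtain ⟨c, hc⟩ := h.2 v hXv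
  have hc0 : c ≠ 0 := by
    rintro rfl
    exact hv (by rw [hc, zero_smul])
  exact ⟨c⁻¹, inv_ne_zero hc0, by rw [hc, smul_smul, inv_mul_cancel₀ hc0, one_smul]⟩

/-- Otherwise β(Y) lies in the kernel of every member, and β(sX + Y) is a quadratic polynomial in
`s` times β(Y), with nonzero leading coefficient. At a root the Pfaffian vector of a nonzero member
vanishes. -/
theorem IsRegularPencil.mulVec_betaDiag_ne_zero [IsAlgClosed K] {X Y : Matrix (Fin 5) (Fin 5) K}
    (h : IsRegularPencil X Y) : X *ᵥ betaDiag Y ≠ 0 := by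
  intro h0
  have hY := h.right.mulVec_betaDiag
  have hc : betaDiag Y ≠ 0 := h.symm.hasPfaffianKernel_left.1
  obtain ⟨x, hx0, hx⟩ := h.hasPfaffianKernel_left.exists_eq_smul hc h0
  have h1 := h.hasPfaffianKernel 1 1 (Or.inl one_ne_zero)
  rw [one_smul, one_smul] at h1
  obtain ⟨w, -, hw⟩ := h1.exists_eq_smul hc (by rw [Matrix.add_mulVec, h0, hY, add_zero])
  obtain ⟨s, hs⟩ := IsAlgClosed.exists_root (Polynomial.C x * Polynomial.X ^ 2 +
    Polynomial.C (w - x - 1) * Polynomial.X + Polynomial.C 1)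
    (by rw [Polynomial.degree_quadratic hx0]; decide)
  simp only [Polynomial.IsRoot, Polynomial.eval_add, Polynomial.eval_mul, Polynomial.eval_C,
    Polynomial.eval_pow, Polynomial.eval_X] at hs
  apply h.betaDiag_smul_add_ne_zero s
  rw [betaPolar_eq, hw, hx]
  have : s ^ 2 • x • betaDiag Y + s • (w • betaDiag Y - x • betaDiag Y - betaDiag Y) + betaDiag Y =
      (x * s ^ 2 + (w - x - 1) * s + 1) • betaDiag Y := by module
  rw [this, hs, zero_smul]

/-- Applying `B` and `C` to a relation with `r ≠ 0` forces `p * q = r²`, and then β((p/r)B + C) = 0,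
which is excluded. With `r = 0` only the nonzero vectors B β(C) and C β(B) remain. -/
theorem IsRegularPencil.linearIndependent [IsAlgClosed K] {B C : Matrix (Fin 5) (Fin 5) K}
    (h : IsRegularPencil B C) {p q r : K}
    (h0 : p • betaDiag B + q • betaDiag C + r • betaPolar B C = 0) :
    p = 0 ∧ q = 0 ∧ r = 0 := by
  have hf : B *ᵥ betaDiag C ≠ 0 := h.mulVec_betaDiag_ne_zero
  have hg : C *ᵥ betaDiag B ≠ 0 := h.symm.mulVec_betaDiag_ne_zero
  have hB := h.left.mulVec_betaDiag
  have hC := h.right.mulVec_betaDiag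
  have hBd := mulVec_betaPolar_add_mulVec_betaDiag h.left h.right
  have hCd := mulVec_betaPolar_add_mulVec_betaDiag h.right h.left
  rw [betaPolar_comm] at hCd
  have e1 := congrArg (B *ᵥ ·) h0
  have e2 := congrArg (C *ᵥ ·) h0
  simp only [Matrix.mulVec_add, Matrix.mulVec_smul, Matrix.mulVec_zero, hB, hC, smul_zero,
    zero_add, add_zero, eq_neg_of_add_eq_zero_left hBd, eq_neg_of_add_eq_zero_left hCd] at e1 e2
  have hr : r = 0 := by
    by_contra hr
    have hpq : (p * q - r * r) • (B *ᵥ betaDiag C) = 0 := by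
      have : (p * q - r * r) • (B *ᵥ betaDiag C) =
          p • (q • B *ᵥ betaDiag C + r • -(C *ᵥ betaDiag B)) +
            r • (p • C *ᵥ betaDiag B + r • -(B *ᵥ betaDiag C)) := by module
      rw [this, e1, e2, smul_zero, smul_zero, add_zero]
    have hpq' : p * q = r * r := by
      rcases smul_eq_zero.mp hpq with h | h
      · linear_combination h
      · exact absurd h hf
    have hd : betaPolar B C = (-(p / r)) • betaDiag B + (-(q / r)) • betaDiag C := by
      have := congrArg (r⁻¹ • ·) h0
      simp only [smul_add, smul_smul, smul_zero, inv_mul_cancel₀ hr, one_smul] at this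
      rw [← sub_eq_zero, ← this]
      module
    apply h.betaDiag_smul_add_ne_zero (p / r)
    rw [hd]
    have : (p / r) ^ 2 • betaDiag B + (p / r) • ((-(p / r)) • betaDiag B + (-(q / r)) • betaDiag C)
        + betaDiag C = (1 - p * q / (r * r)) • betaDiag C := by module
    rw [this, hpq', div_self (mul_ne_zero hr hr), sub_self, zero_smul]
  subst hr
  simp only [zero_smul, add_zero] at e1 e2
  exact ⟨(smul_eq_zero.mp e2).resolve_right hg, (smul_eq_zero.mp e1).resolve_right hf, rfl⟩

/-- A `3 × 2` matrix of linear forms of a special shape drops rank. -/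
theorem exists_rank_one_matrix [IsAlgClosed K] (b c m n : K) :
    ∃ Y Z w₁ w₂ r₀ r₁ r₂ : K, (b = r₀ * w₁ ∧ Z = r₀ * w₂) ∧ (Y = r₁ * w₁ ∧ c = r₁ * w₂) ∧
      (m - Z = r₂ * w₁ ∧ n - Y = r₂ * w₂) := by
  by_cases hb : b = 0
  · exact ⟨0, m, 0, 1, m, c, n, by simp [hb]⟩
  by_cases hc : c = 0
  · exact ⟨n, 0, 1, 0, b, n, m, by simp [hc]⟩
  -- With the common row direction normalized to (1, -x), the first two rows fix `Z` and `Y`, and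
  -- proportionality of the third is this cubic in `x`.
  obtain ⟨x, hx⟩ := IsAlgClosed.exists_root (Polynomial.C b * Polynomial.X ^ 3 +
    Polynomial.C m * Polynomial.X ^ 2 + Polynomial.C n * Polynomial.X + Polynomial.C c)
    (by rw [Polynomial.degree_cubic hb]; decide)
  simp only [Polynomial.IsRoot, Polynomial.eval_add, Polynomial.eval_mul, Polynomial.eval_C,
    Polynomial.eval_pow, Polynomial.eval_X] at hx
  have hx0 : x ≠ 0 := by
    rintro rfl
    simp [hc] at hx
  refine ⟨-(c / x), -(b * x), 1, -x, b, -(c / x), m + b * x, ⟨by ring, by ring⟩,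
    ⟨by ring, by field_simp⟩, by ring, ?_⟩
  field_simp
  linear_combination hx

/-- Three independent vectors in `K ^ 5` have a two-dimensional annihilator. -/
theorem exists_eq_smul_add_smul {u : Fin 3 → Fin 5 → K} (hu : LinearIndependent K u)
    {f g : Fin 5 → K} (hfg : LinearIndependent K ![f, g]) (hf : ∀ i, u i ⬝ᵥ f = 0)
    (hg : ∀ i, u i ⬝ᵥ g = 0) {φ : Fin 5 → K} (hφ : ∀ i, u i ⬝ᵥ φ = 0) :
    ∃ x y : K, φ = x • f + y • g := by
  let N : Matrix (Fin 3) (Fin 5) K := Matrix.of u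
  have hk : Module.finrank K (LinearMap.ker N.mulVecLin) = 2 := by
    have h := LinearMap.finrank_range_add_finrank_ker N.mulVecLin
    have hN : N.rank = 3 := by
      have := LinearIndependent.rank_matrix (M := N) hu
      rwa [Fintype.card_fin] at this
    rw [Module.finrank_fin_fun] at h
    change N.rank + _ = 5 at h
    omega
  let v : Fin 2 → LinearMap.ker N.mulVecLin := ![⟨f, funext hf⟩, ⟨g, funext hg⟩]
  have hv : LinearIndependent K v := by
    refine LinearIndependent.of_comp (LinearMap.ker N.mulVecLin).subtype ?_
    convert hfg using 1
    ext i : 1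
    fin_cases i <;> rfl
  have hs := hv.span_eq_top_of_card_eq_finrank' (by rw [hk, Fintype.card_fin])
  have hm : (⟨φ, funext hφ⟩ : LinearMap.ker N.mulVecLin) ∈ Submodule.span K (Set.range v) := by
    rw [hs]
    trivial
  rw [Matrix.range_cons, Matrix.range_cons, Matrix.range_empty, Set.union_empty,
    Set.singleton_union, Submodule.mem_span_pair] at hm
  obtain ⟨x, y, hxy⟩ := hm
  exact ⟨x, y, (congrArg Subtype.val hxy).symm⟩

end Field

/-! ### Regular nets over an algebraically closed field: det P' ≠ 0 -/

section Degenerate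

variable {K : Type*} [Field K]

/-- A net of alternating forms all of whose nonzero members have rank `4`. -/
structure IsRegularNet (X : Fin 3 → Matrix (Fin 5) (Fin 5) K) : Prop where
  isAlternating : ∀ k, IsAlternating (X k)
  hasPfaffianKernel : ∀ t : Fin 3 → K, t ≠ 0 → HasPfaffianKernel (∑ k, t k • X k)

theorem IsRegularNet.isRegularPencil {X : Fin 3 → Matrix (Fin 5) (Fin 5) K} (hX : IsRegularNet X)
    {i j : Fin 3} (hij : i ≠ j) : IsRegularPencil (X i) (X j) := by
  refine ⟨hX.isAlternating i, hX.isAlternating j, fun s t hst => ?_⟩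
  have h := hX.hasPfaffianKernel (Pi.single i s + Pi.single j t) (fun h0 => by
    have hi := congrFun h0 i
    have hj := congrFun h0 j
    simp [hij, hij.symm] at hi hj
    tauto)
  simpa [add_smul, Finset.sum_add_distrib, Pi.single_apply] using h

theorem IsRegularNet.sum_smul {X : Fin 3 → Matrix (Fin 5) (Fin 5) K} (hX : IsRegularNet X)
    {h : Matrix (Fin 3) (Fin 3) K} (hh : h.det ≠ 0) :
    IsRegularNet fun i => ∑ k, h i k • X k := by
  refine ⟨fun i => IsAlternating.sum_smul hX.isAlternating _, fun t ht => ?_⟩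
  have e : ∑ i, t i • ∑ k, h i k • X k = ∑ k, (t ᵥ* h) k • X k := by
    simp only [Finset.smul_sum, smul_smul, Matrix.vecMul, dotProduct, Finset.sum_smul]
    exact Finset.sum_comm
  rw [e]
  refine hX.hasPfaffianKernel _ fun h0 => hh ?_
  exact exists_vecMul_eq_zero_iff.mp ⟨t, ht, h0⟩

theorem exists_det_ne_zero_of_row_eq {v : Fin 3 → K} (hv : v ≠ 0) :
    ∃ h : Matrix (Fin 3) (Fin 3) K, h.det ≠ 0 ∧ h 2 = v := by
  by_cases h0 : v 0 = 0
  · by_cases h1 : v 1 = 0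
    · have h2 : v 2 ≠ 0 := fun h2 => hv (by ext i; fin_cases i <;> assumption)
      exact ⟨Matrix.of ![![1, 0, 0], ![0, 1, 0], v], by simp [det_fin_three, h2], rfl⟩
    · exact ⟨Matrix.of ![![1, 0, 0], ![0, 0, 1], v], by simp [det_fin_three, h1], rfl⟩
  · exact ⟨Matrix.of ![![0, 1, 0], ![0, 0, 1], v], by simp [det_fin_three, h0], rfl⟩

theorem exists_det_ne_zero_of_two_rows_eq {x y : K} (hxy : x ≠ 0 ∨ y ≠ 0) :
    ∃ h : Matrix (Fin 3) (Fin 3) K, h.det ≠ 0 ∧ h 1 = ![x, y, 0] ∧ h 2 = ![0, 0, 1] := by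
  by_cases hx : x = 0
  · exact ⟨Matrix.of ![![1, 0, 0], ![x, y, 0], ![0, 0, 1]],
      by simpa [det_fin_three, hx] using hxy, rfl, rfl⟩
  · exact ⟨Matrix.of ![![0, 1, 0], ![x, y, 0], ![0, 0, 1]],
      by simpa [det_fin_three] using hx, rfl, rfl⟩

theorem conj_apply_eq_zero {P h : Matrix (Fin 3) (Fin 3) K} {v : Fin 3 → K} (hP : P *ᵥ v = 0)
    {j : Fin 3} (hj : h j = v) (c : K) (i : Fin 3) : (c • (h * P * hᵀ)) i j = 0 := by
  have : (h * P * hᵀ) i j = (h *ᵥ (P *ᵥ v)) i := by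
    rw [Matrix.mulVec_mulVec, ← hj]
    simp [Matrix.mul_apply (M := h * P), Matrix.mulVec, dotProduct]
  rw [Matrix.smul_apply, this, hP, Matrix.mulVec_zero, Pi.zero_apply, smul_zero]

variable [IsAlgClosed K]

/-- In a regular net, a null vector of `P'` forces `Q` to vanish. -/
theorem IsRegularNet.gramMatrix_eq_zero {X : Fin 3 → Matrix (Fin 5) (Fin 5) K}
    (hX : IsRegularNet X) (h : ∀ i, ochiaiMatrix (X 0) (X 1) (X 2) i 2 = 0) :
    gramMatrix (X 0) (X 1) (X 2) = 0 := by
  have hξ : X 0 *ᵥ betaDiag (X 2) ≠ 0 :=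
    (hX.isRegularPencil (by decide : (0 : Fin 3) ≠ 2)).mulVec_betaDiag_ne_zero
  -- Column 4 of the table for `A` involves only the last column of P', so the nonzero vector A β(C)
  -- annihilates all six β-vectors.
  have hu : ∀ i, betaMatrix (X 0) (X 1) (X 2) i ⬝ᵥ (X 0 *ᵥ betaDiag (X 2)) = 0 := by
    intro i
    rw [← bracket_eq_dotProduct]
    have := bracket_betaMatrix_net hX.isAlternating 0 i 4
    refine this.trans ?_
    have h0 := h 0
    have h1 := h 1
    have h2 := h 2
    generalize ochiaiMatrix (X 0) (X 1) (X 2) = P at *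
    fin_cases i <;> simp [pairingMatrix, h0, h1, h2]
  have hm : ∀ i, rowMinor (X 0) (X 1) (X 2) i = 0 := by
    intro i
    rw [rowMinor_eq_det_betaMatrix]
    exact exists_mulVec_eq_zero_iff.mp ⟨_, hξ, funext fun r => hu (i.succAbove r)⟩
  ext i j
  fin_cases i <;> fin_cases j <;> simp [gramMatrix, hm]

/-- In a regular net, the kernel of `P'` is at most one-dimensional. -/
theorem IsRegularNet.false_of_ochiaiMatrix {X : Fin 3 → Matrix (Fin 5) (Fin 5) K}
    (hX : IsRegularNet X) (h1 : ∀ i, ochiaiMatrix (X 0) (X 1) (X 2) i 1 = 0)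
    (h2 : ∀ i, ochiaiMatrix (X 0) (X 1) (X 2) i 2 = 0) : False := by
  have hBC := hX.isRegularPencil (by decide : (1 : Fin 3) ≠ 2)
  have hli := fun p q r => hBC.linearIndependent (p := p) (q := q) (r := r)
  -- Indices 2, 4, 1 select β(B), β(C), β(B,C). Their pairings avoid `P 0 0`, the only entry that
  -- can survive, so they span a 3-space isotropic for the net.
  have hpair : ∀ (k : Fin 3) (i j : Fin 3),
      betaMatrix (X 0) (X 1) (X 2) (![2, 4, 1] i) ⬝ᵥ
        (X k *ᵥ betaMatrix (X 0) (X 1) (X 2) (![2, 4, 1] j)) = 0 := by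
    intro k i j
    rw [← bracket_eq_dotProduct]
    refine (bracket_betaMatrix_net hX.isAlternating k _ _).trans ?_
    have h01 := h1 0
    have h02 := h2 0
    have h11 := h1 1
    have h12 := h2 1
    have h22 := h2 2
    generalize ochiaiMatrix (X 0) (X 1) (X 2) = P at *
    fin_cases k <;> fin_cases i <;> fin_cases j <;>
      simp [pairingMatrix, h01, h02, h11, h12, h22]
  set u : Fin 3 → Fin 5 → K := ![betaDiag (X 1), betaDiag (X 2), betaPolar (X 1) (X 2)] with hu
  have hpair' : ∀ (k i j : Fin 3), u i ⬝ᵥ (X k *ᵥ u j) = 0 := by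
    have e : ∀ i, u i = betaMatrix (X 0) (X 1) (X 2) (![2, 4, 1] i) := by
      intro i
      fin_cases i <;> rfl
    intro k i j
    rw [e, e, hpair]
  have hind : LinearIndependent K u := by
    rw [Fintype.linearIndependent_iff]
    intro c hc
    rw [Fin.sum_univ_three] at hc
    obtain ⟨a0, a1, a2⟩ := hli _ _ _ hc
    intro i
    fin_cases i <;> assumption
  have hBb : X 1 *ᵥ betaDiag (X 1) = 0 := (hX.isAlternating 1).mulVec_betaDiag
  have hCc : X 2 *ᵥ betaDiag (X 2) = 0 := (hX.isAlternating 2).mulVec_betaDiag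
  have hBd : X 1 *ᵥ betaPolar (X 1) (X 2) = -(X 2 *ᵥ betaDiag (X 1)) :=
    eq_neg_of_add_eq_zero_left
      (mulVec_betaPolar_add_mulVec_betaDiag (hX.isAlternating 1) (hX.isAlternating 2))
  have hCd : X 2 *ᵥ betaPolar (X 1) (X 2) = -(X 1 *ᵥ betaDiag (X 2)) := by
    rw [betaPolar_comm]
    exact eq_neg_of_add_eq_zero_left
      (mulVec_betaPolar_add_mulVec_betaDiag (hX.isAlternating 2) (hX.isAlternating 1))
  set f := X 1 *ᵥ betaDiag (X 2) with hf
  set g := X 2 *ᵥ betaDiag (X 1) with hg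
  have hfg : LinearIndependent K ![f, g] := by
    rw [LinearIndependent.pair_iff]
    intro x y hxy
    have hk : X 1 *ᵥ (x • betaDiag (X 2) + (-y) • betaPolar (X 1) (X 2)) = 0 := by
      rw [Matrix.mulVec_add, Matrix.mulVec_smul, Matrix.mulVec_smul, hBd, ← hf, ← hxy]
      module
    obtain ⟨c, hc⟩ := hBC.hasPfaffianKernel_left.2 _ hk
    obtain ⟨-, hx, hy⟩ := hli (-c) x (-y) (by
      rw [add_assoc, hc]
      module)
    exact ⟨hx, neg_eq_zero.mp hy⟩
  -- The annihilator of the isotropic 3-space is a plane with basis `f`, `g`, so each member of the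
  -- net acts from that space to this plane as a 3 × 2 matrix.
  have hcomb : ∀ j, ∃ x y : K, X 0 *ᵥ u j = x • f + y • g := fun j =>
    exists_eq_smul_add_smul hind hfg (fun i => hpair' 1 i 1) (fun i => hpair' 2 i 0)
      fun i => hpair' 0 i j
  obtain ⟨b1, b2, hb⟩ := hcomb 0
  obtain ⟨c1, c2, hc⟩ := hcomb 1
  obtain ⟨d1, d2, hd⟩ := hcomb 2
  change X 0 *ᵥ betaDiag (X 1) = _ at hb
  change X 0 *ᵥ betaDiag (X 2) = _ at hc
  change X 0 *ᵥ betaPolar (X 1) (X 2) = _ at hd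
  obtain ⟨Y, Z, w₁, w₂, r₀, r₁, r₂, ⟨e1, e2⟩, ⟨e3, e4⟩, e5, e6⟩ :=
    exists_rank_one_matrix b1 c2 (d1 + b2) (d2 + c1)
  -- The shifts by `c1` and `b2` bring the 3 × 2 matrix of `T` to the shape of
  -- `exists_rank_one_matrix`, with rank at most 1.
  set T := ∑ k, (![1, Y - c1, Z - b2] : Fin 3 → K) k • X k with hT
  have hker : HasPfaffianKernel T := hX.hasPfaffianKernel _ fun h0 => by
    simpa using congrFun h0 0
  have hTv : ∀ v, T *ᵥ v = X 0 *ᵥ v + (Y - c1) • X 1 *ᵥ v + (Z - b2) • X 2 *ᵥ v := by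
    intro v
    simp [hT, Fin.sum_univ_three, Matrix.add_mulVec, Matrix.smul_mulVec]
  have hTb : T *ᵥ betaDiag (X 1) = r₀ • (w₁ • f + w₂ • g) := by
    rw [hTv, hb, hBb, ← hg]
    have : r₀ • (w₁ • f + w₂ • g) = (r₀ * w₁) • f + (r₀ * w₂) • g := by module
    rw [this, ← e1, ← e2]
    module
  have hTc : T *ᵥ betaDiag (X 2) = r₁ • (w₁ • f + w₂ • g) := by
    rw [hTv, hc, hCc, ← hf]
    have : r₁ • (w₁ • f + w₂ • g) = (r₁ * w₁) • f + (r₁ * w₂) • g := by module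
    rw [this, ← e3, ← e4]
    module
  have hTd : T *ᵥ betaPolar (X 1) (X 2) = r₂ • (w₁ • f + w₂ • g) := by
    rw [hTv, hd, hBd, hCd]
    have : r₂ • (w₁ • f + w₂ • g) = (r₂ * w₁) • f + (r₂ * w₂) • g := by module
    rw [this, ← e5, ← e6]
    module
  have hline : ∀ p q r : K, p * r₀ + q * r₁ + r * r₂ = 0 → ∃ c : K,
      p • betaDiag (X 1) + q • betaDiag (X 2) + r • betaPolar (X 1) (X 2) = c • betaDiag T := by
    intro p q r hpqr
    refine hker.2 _ ?_
    rw [Matrix.mulVec_add, Matrix.mulVec_add, Matrix.mulVec_smul, Matrix.mulVec_smul,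
      Matrix.mulVec_smul, hTb, hTc, hTd, smul_smul, smul_smul, smul_smul, ← add_smul, ← add_smul,
      hpqr, zero_smul]
  -- Solutions of one linear equation in three unknowns map into the line ker `T`, hence are
  -- pairwise proportional. This fails already for the obvious solutions, first forcing all `r`
  -- coefficients to vanish.
  have hcross : ∀ p q r p' q' r' : K, p * r₀ + q * r₁ + r * r₂ = 0 →
      p' * r₀ + q' * r₁ + r' * r₂ = 0 → p * q' = q * p' ∧ p * r' = r * p' ∧ q * r' = r * q' := by
    intro p q r p' q' r' h h'
    obtain ⟨c, hc⟩ := hline p q r h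
    obtain ⟨c', hc'⟩ := hline p' q' r' h'
    by_cases hc0 : c = 0
    · rw [hc0, zero_smul] at hc
      obtain ⟨rfl, rfl, rfl⟩ := hli _ _ _ hc
      simp
    · obtain ⟨k1, k2, k3⟩ := hli (c' * p - c * p') (c' * q - c * q') (c' * r - c * r') (by
        have : (c' * p - c * p') • betaDiag (X 1) + (c' * q - c * q') • betaDiag (X 2) +
            (c' * r - c * r') • betaPolar (X 1) (X 2) =
            c' • (p • betaDiag (X 1) + q • betaDiag (X 2) + r • betaPolar (X 1) (X 2)) -
            c • (p' • betaDiag (X 1) + q' • betaDiag (X 2) + r' • betaPolar (X 1) (X 2)) := by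
          module
        rw [this, hc, hc']
        module)
      refine ⟨mul_left_cancel₀ hc0 ?_, mul_left_cancel₀ hc0 ?_, mul_left_cancel₀ hc0 ?_⟩
      · linear_combination q * k1 - p * k2
      · linear_combination r * k1 - p * k3
      · linear_combination r * k2 - q * k3
  have hr0 : r₀ = 0 := by
    have := (hcross r₁ (-r₀) 0 r₂ 0 (-r₀) (by ring) (by ring)).2.2
    simpa using this
  have hr1 : r₁ = 0 := by
    have := (hcross r₁ (-r₀) 0 0 r₂ (-r₁) (by ring) (by ring)).2.1
    simpa using this
  have hr2 : r₂ = 0 := by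
    have := (hcross r₂ 0 (-r₀) 0 r₂ (-r₁) (by ring) (by ring)).1
    simpa using this
  have := (hcross 1 0 0 0 1 0 (by simp [hr0]) (by simp [hr1])).1
  simp at this

/-- Two changes of basis of the net. The first makes a null vector of P' the third basis vector,
whence adj P' = 0. The second fixes that vector and brings a null vector of the upper left 2 × 2
block to second place, so two columns of P' vanish. -/
theorem IsRegularNet.det_ochiaiMatrix_ne_zero {X : Fin 3 → Matrix (Fin 5) (Fin 5) K}
    (hX : IsRegularNet X) : (ochiaiMatrix (X 0) (X 1) (X 2)).det ≠ 0 := by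
  intro hdet
  obtain ⟨v, hv, hPv⟩ := exists_mulVec_eq_zero_iff.mpr hdet
  obtain ⟨h, hh, hv2⟩ := exists_det_ne_zero_of_row_eq hv
  have hX' := hX.sum_smul hh
  set X' := fun i => ∑ k, h i k • X k with hX'_def
  have hP' : ochiaiMatrix (X' 0) (X' 1) (X' 2) =
      h.det • (h * ochiaiMatrix (X 0) (X 1) (X 2) * hᵀ) := ochiaiMatrix_sum_smul hX.isAlternating h
  have hz : ∀ i, ochiaiMatrix (X' 0) (X' 1) (X' 2) i 2 = 0 := fun i => by
    rw [hP']
    exact conj_apply_eq_zero hPv hv2 _ i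
  have hQ := hX'.gramMatrix_eq_zero hz
  have hs := ochiaiMatrix_isSymm (X' 0) (X' 1) (X' 2)
  rw [← adjugate_ochiaiMatrix (hX'.isAlternating 0) (hX'.isAlternating 1) (hX'.isAlternating 2)]
    at hQ
  have h22 := congrFun (congrFun hQ 2) 2
  rw [adjugate_fin_three] at h22
  have hsub : Matrix.det !![ochiaiMatrix (X' 0) (X' 1) (X' 2) 0 0,
      ochiaiMatrix (X' 0) (X' 1) (X' 2) 0 1; ochiaiMatrix (X' 0) (X' 1) (X' 2) 1 0,
      ochiaiMatrix (X' 0) (X' 1) (X' 2) 1 1] = 0 := by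
    rw [det_fin_two]
    exact h22
  obtain ⟨w, hw, hPw⟩ := exists_mulVec_eq_zero_iff.mpr hsub
  have hw' : w 0 ≠ 0 ∨ w 1 ≠ 0 := by
    by_contra! hc
    exact hw (by ext i; fin_cases i; exacts [hc.1, hc.2])
  obtain ⟨h', hh', hr1, hr2⟩ := exists_det_ne_zero_of_two_rows_eq hw'
  have hX'' := hX'.sum_smul hh'
  have hP'' : ochiaiMatrix (∑ k, h' 0 k • X' k) (∑ k, h' 1 k • X' k) (∑ k, h' 2 k • X' k) =
      h'.det • (h' * ochiaiMatrix (X' 0) (X' 1) (X' 2) * h'ᵀ) :=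
    ochiaiMatrix_sum_smul hX'.isAlternating h'
  have hz0 := hz 0
  have hz1 := hz 1
  have hz2 := hz 2
  have z02 := hs.apply 0 2
  have z12 := hs.apply 1 2
  generalize ochiaiMatrix (X' 0) (X' 1) (X' 2) = P at *
  refine hX''.false_of_ochiaiMatrix (fun i => ?_) (fun i => ?_)
  · rw [hP'']
    refine conj_apply_eq_zero ?_ hr1 _ i
    have p0 := congrFun hPw 0
    have p1 := congrFun hPw 1
    simp [Matrix.mulVec, dotProduct, Fin.sum_univ_two] at p0 p1
    ext a
    fin_cases a <;>
      simp [Matrix.mulVec, dotProduct, Fin.sum_univ_three, p0, p1, z02, z12, hz0, hz1]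
  · rw [hP'']
    refine conj_apply_eq_zero ?_ hr2 _ i
    ext a
    fin_cases a <;> simp [Matrix.mulVec, dotProduct, Fin.sum_univ_three, hz0, hz1, hz2]

end Degenerate

/-! ### Passage from the ring to geometric points -/

section RankFour

variable {R : Type u} [CommRing R] {ν : ⋀[R]^2 (Fin 5 → R) →ₗ[R] (Fin 3 → R)}

theorem IsRankFour.isRegularNet (hν : IsRankFour ν) (K : Type u) [Field K] [Algebra R K] :
    IsRegularNet fun k => (netMatrix ν k).map (algebraMap R K) := by
  have h := fun k => (isAlternating_netMatrix ν k).map (algebraMap R K)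
  exact ⟨h, fun t ht =>
    (IsAlternating.sum_smul h t).hasPfaffianKernel_of_rank_eq_four (hν.2 K t ht)⟩

/-- A non-unit vanishes at some maximal ideal, and the algebraic closure of that residue field,
still in universe `u`, gives a regular net with det P' = 0. -/
theorem IsRankFour.isUnit_evalNet (hν : IsRankFour ν) : IsUnit (evalNet ν netInvariant) := by
  by_contra hu
  obtain ⟨m, hm, hF⟩ := exists_max_ideal_of_mem_nonunits (mem_nonunits_iff.mpr hu)
  let _ : Field (R ⧸ m) := Ideal.Quotient.field m
  let K := AlgebraicClosure (R ⧸ m)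
  have hX := hν.isRegularNet K
  apply hX.det_ochiaiMatrix_ne_zero
  rw [← map_ochiaiMatrix, ← RingHom.mapMatrix_apply, ← RingHom.map_det]
  change algebraMap R K (netOchiai ν).det = 0
  rw [← evalNet_netInvariant, IsScalarTower.algebraMap_apply R (R ⧸ m) K,
    Ideal.Quotient.algebraMap_eq, Ideal.Quotient.eq_zero_iff_mem.mpr hF, map_zero]

end RankFour

end QuinaryNet

end

theorem mainTheorem11 {R : Type u} [CommRing R]
    (ν : ⋀[R]^2 (Fin 5 → R) →ₗ[R] (Fin 3 → R)) :
    -- for a net of rank 4, the form with Gram matrix `Q_ν` is the cokernel of `G_ν`,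
    -- and the invariant `F` is invertible
    (QuinaryNet.IsRankFour ν →
      Function.Surjective (QuinaryNet.symForm (QuinaryNet.netGram ν)) ∧
      LinearMap.ker (QuinaryNet.symForm (QuinaryNet.netGram ν)) =
        LinearMap.range (QuinaryNet.netSquare ν) ∧
      IsUnit (QuinaryNet.evalNet ν QuinaryNet.netInvariant)) ∧
    -- `Q_ν` is the adjugate of `P'`, which is symmetric with determinant `F`
    (QuinaryNet.netOchiai ν).IsSymm ∧
    (QuinaryNet.netOchiai ν).adjugate = QuinaryNet.netGram ν ∧
    QuinaryNet.netOchiai ν * QuinaryNet.netGram ν =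
      QuinaryNet.evalNet ν QuinaryNet.netInvariant • (1 : Matrix (Fin 3) (Fin 3) R) ∧
    QuinaryNet.netGram ν * QuinaryNet.netOchiai ν =
      QuinaryNet.evalNet ν QuinaryNet.netInvariant • (1 : Matrix (Fin 3) (Fin 3) R) ∧
    (QuinaryNet.netOchiai ν).det = QuinaryNet.evalNet ν QuinaryNet.netInvariant ∧
    (QuinaryNet.netGram ν).det = QuinaryNet.evalNet ν QuinaryNet.netInvariant ^ 2 ∧
    -- `F` is a nonzero integral polynomial of multidegree `(5, 5, 5)`
    QuinaryNet.netInvariant ≠ 0 ∧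
    IsWeightedHomogeneous (fun v : QuinaryNet.Var => (Pi.single v.1 1 : Fin 3 → ℕ))
      QuinaryNet.netInvariant (fun _ => 5) ∧
    -- `F` is a relative invariant
    ∀ (g : (Fin 5 → R) →ₗ[R] (Fin 5 → R)) (h : (Fin 3 → R) →ₗ[R] (Fin 3 → R)),
      QuinaryNet.evalNet (h ∘ₗ ν ∘ₗ exteriorPower.map 2 g) QuinaryNet.netInvariant =
        LinearMap.det g ^ 6 * LinearMap.det h ^ 5 *
          QuinaryNet.evalNet ν QuinaryNet.netInvariant := by
  have hadj := QuinaryNet.adjugate_netOchiai ν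
  have hdet := QuinaryNet.evalNet_netInvariant ν
  refine ⟨fun hν => ?_, QuinaryNet.ochiaiMatrix_isSymm _ _ _, hadj, ?_, ?_, hdet.symm,
    QuinaryNet.det_netGram ν, QuinaryNet.netInvariant_ne_zero,
    QuinaryNet.isWeightedHomogeneous_netInvariant, QuinaryNet.evalNet_comp ν⟩
  · have hu := hν.isUnit_evalNet
    have hQ : IsUnit (QuinaryNet.netGram ν).det := by
      rw [QuinaryNet.det_netGram]
      exact hu.pow 2
    exact ⟨QuinaryNet.symForm_surjective ν hQ, QuinaryNet.ker_symForm_eq_range_netSquare ν hQ, hu⟩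
  · rw [← hadj, mul_adjugate, hdet]
  · rw [← hadj, adjugate_mul, hdet]
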